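/- Conventions. A complex orbifold $X$ of dimension $n$ is given by an atlas of uniformising charts $(\tilde U,\Gamma,\varphi)$, where $\tilde U\subset\mathbb C^n$ is a connected open set containing the origin, $\Gamma$ is a finite group acting effectively on $\tilde U$ by biholomorphisms, and $\varphi:\tilde U\to X$ induces a homeomorphism of $\tilde U/\Gamma$ onto an open subset of $X$. An injection $(\tilde U,\Gamma,\varphi)\to(\tilde U',\Gamma',\varphi')$ is a holomorphic embedding $f:\tilde U\to\tilde U'$ with $\varphi'\circ f=\varphi$; the elements of $\Gamma$ are injections of a chart into itself. For $D\subset X$ write $\tilde D=\varphi^{-1}(D\cap\varphi(\tilde U))$. The spaces underlying $N_D\setminus\{0\}$ and $K_D\setminus\{0\}$ are obtained by gluing the spaces $N_{\tilde D}\setminus\{0\}$, respectively $K_{\tilde D}\setminus\{0\}$, of all charts along the maps induced by all injections, where $N_{\tilde D}=T\tilde U|_{\tilde D}/T\tilde D$ is the holomorphic normal bundle and $K_{\tilde D}=\Lambda^{n-1}T^*\tilde D$ the canonical bundle of $\tilde D$. A map of orbifolds $N_D\setminus\{0\}\to K_D\setminus\{0\}$ is a map of these spaces together with lifts $N_{\tilde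 D}\setminus\{0\}\to K_{\tilde D}\setminus\{0\}$ that are compatible with all injections (so each is $\Gamma$-equivariant). It is holomorphic if its lifts are, and it is an unbranched $k$-fold covering map if it is continuous and surjective and each lift is a covering map all of whose fibres have exactly $k$ points. A holomorphic volume form $\Omega$ on $X\setminus D$ is a family of nowhere vanishing holomorphic $n$-forms $\varphi^*\Omega$ on the sets $\tilde U\setminus\tilde D$ that is compatible with all injections. It blows up to order $\alpha$ along $D$ if, for local defining functions $s$ of $\tilde D$ (holomorphic, with zero set $\tilde D$ and $ds\neq0$ along $\tilde D$), $s^\alpha\varphi^*\Omega$ extends to a nowhere vanishing holomorphic form across $\tilde D$. **Corollary 2.3.** Let $X$ be a compact (Hausdorff) Kähler orbifold of complex dimension $n\ge1$ and let $D\subset X$ be a complex suborbifold of codimension one that contains the singular points of $X$ (those with non-trivial isotropy group) and satisfies $-K_X=\alpha[D]$ (an isomorphism of holomorphic line orbibundles) for some integer $\alpha\ge2$. Assume that every point of $D$ lies in $\varphi(\tilde U)$ for some uniformising chart $(\tilde U,\Gamma,\varphi)$ that is adapted, that is, which admits holomorphic coordinates $(z_1,\dots,z_n)$ on $\tilde U$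 such that (i) $\tilde D=\{z_n=0\}$, and (ii) each $\gamma\in\Gamma$ acts in these coordinates as a matrix $\begin{pmatrix}A&\star\\0&b\end{pmatrix}$ with $A\in GL(n-1,\mathbb C)$ and $b^{\alpha-1}=\det A$. Then there is a holomorphic volume form on $X\setminus D$ that blows up to order $\alpha$ along $D$. For every such form $\Omega$ there is an unbranched holomorphic $(\alpha-1)$-fold covering map of orbifolds $$\phi_\Omega:N_D\setminus\{0\}\longrightarrow K_D\setminus\{0\}$$ which, in every adapted uniformising chart $(\tilde U,\Gamma,\varphi)$, for every holomorphic function $s$ on $\tilde U$ with $\tilde D=\{s=0\}$ and $ds\ne0$ along $\tilde D$, and at every $z\in\tilde D$, is given by $$\Bigl(z,\ \lambda\,\frac{\partial}{\partial s}\Bigr)\longmapsto\Bigl(z,\ \lambda^{1-\alpha}\,\bigl((s^\alpha\varphi^*\Omega)\lrcorner\tfrac{\partial}{\partial s}\bigr)\big|_{\tilde D}\Bigr),\qquad\lambda\in\mathbb C^*,$$ where $\frac{\partial}{\partial s}$ is the section of $N_{\tilde D}$ on which $ds|_{\tilde D}$ evaluates to one, and $s^\alpha\varphi^*\Omega$ stands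 for its holomorphic extension to $\tilde U$. The map $\phi_\Omega$ depends only on $\Omega$: it is the only map of orbifolds that is given by this formula in all adapted charts. -/

import Mathlib

open scoped Topology ContDiff

universe u

/-! ### Complex orbifolds -/

/-- The model space `ℂⁿ`. -/
abbrev CSpace (n : ℕ) : Type := Fin n → ℂ

/-- A holomorphic uniformising chart `(Ũ, Γ, φ)` of complex dimension `n` on `X`: `Ũ` is a connected
open subset of `ℂⁿ` containing the origin, `Γ` is a finite group acting effectively on `Ũ` by
biholomorphisms, and `φ : Ũ → X` induces a homeomorphism of `Ũ / Γ` onto an open subset of `X`.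
As the action is effective, `Γ` is given as a finite group of bijections of `Ũ`; each of them is
extended to `ℂⁿ` by the identity outside `Ũ`. The values of `proj` outside `Ũ` play no role. -/
structure OrbChart (X : Type u) [TopologicalSpace X] (n : ℕ) where
  /-- the domain `Ũ` -/
  U : Set (CSpace n)
  isOpen_U : IsOpen U
  isPreconnected_U : IsPreconnected U
  zero_mem : (0 : CSpace n) ∈ U
  /-- the local uniformising group `Γ` -/
  Γ : Subgroup (Equiv.Perm (CSpace n))
  finite_Γ : Finite Γ
  act_mem : ∀ γ ∈ Γ, ∀ z ∈ U, γ z ∈ U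
  act_off : ∀ γ ∈ Γ, ∀ z, z ∉ U → γ z = z
  act_holo : ∀ γ ∈ Γ, DifferentiableOn ℂ (γ : CSpace n → CSpace n) U
  /-- the map `φ` -/
  proj : CSpace n → X
  proj_cont : ContinuousOn proj U
  proj_open : ∀ V, V ⊆ U → IsOpen V → IsOpen (proj '' V)
  proj_eq_iff : ∀ z ∈ U, ∀ w ∈ U, proj z = proj w ↔ ∃ γ ∈ Γ, γ z = w

/-- The open set `φ(Ũ)` of `X`. -/
def OrbChart.range {X : Type u} [TopologicalSpace X] {n : ℕ} (c : OrbChart X n) : Set X :=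
  c.proj '' c.U

/-- `D̃ = φ⁻¹(D ∩ φ(Ũ))`. -/
def OrbChart.pre {X : Type u} [TopologicalSpace X] {n : ℕ} (c : OrbChart X n) (D : Set X) :
    Set (CSpace n) :=
  {z | z ∈ c.U ∧ c.proj z ∈ D}

/-- `f` is an injection `(Ũ, Γ, φ) → (Ũ', Γ', φ')` of charts: a holomorphic embedding
`f : Ũ → Ũ'` (an injective immersion between open sets of the same dimension) with `φ' ∘ f = φ`.
The values of `f` outside `Ũ` play no role. -/
structure IsInjection {X : Type u} [TopologicalSpace X] {n : ℕ} (c d : OrbChart X n)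
    (f : CSpace n → CSpace n) : Prop where
  mapsTo : Set.MapsTo f c.U d.U
  holo : DifferentiableOn ℂ f c.U
  injOn : Set.InjOn f c.U
  immersion : ∀ z ∈ c.U, Function.Injective (fderiv ℂ f z)
  proj_comp : ∀ z ∈ c.U, d.proj (f z) = c.proj z

/-- The elements of the local uniformising group are injections of the chart into itself, so that
everything that is required below for all injections includes invariance (or equivariance) under
the local uniformising groups. -/
theorem OrbChart.isInjection_of_mem {X : Type u} [TopologicalSpace X] {n : ℕ} (c : OrbChart X n)
    {γ : Equiv.Perm (CSpace n)} (hγ : γ ∈ c.Γ) : IsInjection c c γ where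
  mapsTo := fun z hz => c.act_mem γ hγ z hz
  holo := c.act_holo γ hγ
  injOn := γ.injective.injOn
  immersion := by
    intro z hz
    have hd : DifferentiableAt ℂ (γ : CSpace n → CSpace n) z :=
      (c.act_holo γ hγ).differentiableAt (c.isOpen_U.mem_nhds hz)
    have hd' : DifferentiableAt ℂ ((γ⁻¹ : Equiv.Perm (CSpace n)) : CSpace n → CSpace n) (γ z) :=
      (c.act_holo γ⁻¹ (c.Γ.inv_mem hγ)).differentiableAt
        (c.isOpen_U.mem_nhds (c.act_mem γ hγ z hz))
    have hc := (hd'.hasFDerivAt.comp z hd.hasFDerivAt).fderiv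
    have hid : ((γ⁻¹ : Equiv.Perm (CSpace n)) : CSpace n → CSpace n) ∘ γ = id := by
      funext w
      simp
    rw [hid, fderiv_id] at hc
    intro v w hvw
    have hv := congrArg (fun L : CSpace n →L[ℂ] CSpace n => L v) hc
    have hw := congrArg (fun L : CSpace n →L[ℂ] CSpace n => L w) hc
    simp only [ContinuousLinearMap.comp_apply, ContinuousLinearMap.id_apply] at hv hw
    rw [hv, hw, hvw]
  proj_comp := fun z hz =>
    ((c.proj_eq_iff z hz (γ z) (c.act_mem γ hγ z hz)).2 ⟨γ, hγ, rfl⟩).symm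

/-- A family of charts is an orbifold atlas of `X`. -/
structure IsOrbAtlas {X : Type u} [TopologicalSpace X] {n : ℕ} (A : Set (OrbChart X n)) :
    Prop where
  cover : ∀ x : X, ∃ c ∈ A, x ∈ c.range
  compat : ∀ c ∈ A, ∀ d ∈ A, ∀ x ∈ c.range ∩ d.range,
    ∃ e ∈ A, x ∈ e.range ∧ (∃ f, IsInjection e c f) ∧ ∃ g, IsInjection e d g

/-- A complex orbifold of dimension `n` with underlying space `X`, given by an orbifold atlas. The
atlas may be, but is not required to be, the maximal one. -/
structure ComplexOrbifold (X : Type u) [TopologicalSpace X] (n : ℕ) where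
  atlas : Set (OrbChart X n)
  isAtlas : IsOrbAtlas atlas

section Orbifold

variable {X : Type u} [TopologicalSpace X] {n : ℕ}

/-- `Sing(X)`: the points with non-trivial isotropy group. -/
def ComplexOrbifold.singularSet (O : ComplexOrbifold X n) : Set X :=
  {x | ∃ c ∈ O.atlas, ∃ z ∈ c.U, c.proj z = x ∧ ∃ γ ∈ c.Γ, γ ≠ 1 ∧ γ z = z}

/-- The orbifold admits a Kähler form: a closed positive real `(1,1)`-form on each uniformising
chart, preserved by all injections, in particular by the local uniformising groups. -/
def ComplexOrbifold.IsKahler (O : ComplexOrbifold X n) : Prop :=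
  ∃ κ : OrbChart X n → CSpace n → (CSpace n) [⋀^Fin 2]→L[ℝ] ℝ,
    (∀ c ∈ O.atlas, ContDiffOn ℝ ∞ (κ c) c.U ∧
      ∀ z ∈ c.U, extDeriv (κ c) z = 0 ∧
        (∀ v w : CSpace n, κ c z ![Complex.I • v, Complex.I • w] = κ c z ![v, w]) ∧
        ∀ v : CSpace n, v ≠ 0 → 0 < κ c z ![v, Complex.I • v]) ∧
    ∀ c ∈ O.atlas, ∀ d ∈ O.atlas, ∀ f, IsInjection c d f → ∀ z ∈ c.U,
      (κ d (f z)).compContinuousLinearMap ((fderiv ℂ f z).restrictScalars ℝ) = κ c z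

/-! ### Complex suborbifolds of codimension one -/

/-- `s` is holomorphic on `V`, has zero set `S ∩ V` there, and vanishes to order one along it. -/
structure IsDefiningFunctionOn (S V : Set (CSpace n)) (s : CSpace n → ℂ) : Prop where
  holo : DifferentiableOn ℂ s V
  zero_iff : ∀ z ∈ V, s z = 0 ↔ z ∈ S
  deriv_ne : ∀ z ∈ V, z ∈ S → fderiv ℂ s z ≠ 0

/-- `S` is a complex submanifold of codimension one. -/
def IsComplexHypersurface (S : Set (CSpace n)) : Prop :=
  ∀ z ∈ S, ∃ V, IsOpen V ∧ z ∈ V ∧ ∃ s, IsDefiningFunctionOn S V s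

/-- `D` is a complex suborbifold of codimension one: around each of its points there is a
uniformising chart in which the preimage of `D` is a complex submanifold of codimension one. -/
def ComplexOrbifold.IsSuborbifoldCodimOne (O : ComplexOrbifold X n) (D : Set X) : Prop :=
  ∀ p ∈ D, ∃ c ∈ O.atlas, p ∈ c.range ∧ IsComplexHypersurface (c.pre D)

/-- For an injection `f` from one chart to another, with defining functions `s`, `t` of `D` in the
two charts, `u` is the quotient `s / (t ∘ f)`: the transition function of the line orbibundle `[D]`
along `f`. -/
def IsDivisorTransition (c : OrbChart X n) (f : CSpace n → CSpace n) (s t : CSpace n → ℂ)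
    (u : CSpace n → ℂ) : Prop :=
  DifferentiableOn ℂ u c.U ∧ ∀ z ∈ c.U, s z = u z * t (f z)

/-- `-K_X = α[D]`: the line orbibundles `-K_X` and `α[D]` are isomorphic. On an atlas of charts `c`
in which `D` has defining functions `s c`, both bundles are trivial over each chart. The transition
function of `K_X` along an injection `f` is `det (df)`, that of `[D]` is `s c / (s d ∘ f)`. An
isomorphism from `-K_X` to `α[D]` is a family of nowhere vanishing holomorphic functions `θ c` that
intertwines the two systems of transition functions. -/
def ComplexOrbifold.AnticanonicalEq (O : ComplexOrbifold X n) (D : Set X) (α : ℕ) : Prop :=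
  ∃ A ⊆ O.atlas, IsOrbAtlas A ∧ ∃ s : OrbChart X n → CSpace n → ℂ,
    (∀ c ∈ A, IsDefiningFunctionOn (c.pre D) c.U (s c)) ∧
    ∃ θ : OrbChart X n → CSpace n → ℂ,
      (∀ c ∈ A, DifferentiableOn ℂ (θ c) c.U ∧ ∀ z ∈ c.U, θ c z ≠ 0) ∧
      ∀ c ∈ A, ∀ d ∈ A, ∀ f, IsInjection c d f →
        ∃ u, IsDivisorTransition c f (s c) (s d) u ∧
          ∀ z ∈ c.U, θ c z * ((fderiv ℂ f z).det)⁻¹ = u z ^ α * θ d (f z)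

end Orbifold

/-! ### Volume forms with poles, and the basic assumption

From here on the dimension is `n = m + 1`. -/

section Pair

variable {X : Type u} [TopologicalSpace X] {m : ℕ}

/-- The chart `c` admits holomorphic coordinates `ζ` with (i) `D̃ = {ζₙ = 0}` in which (ii) every
`γ ∈ Γ` acts as a matrix with last row `(0, …, 0, b)` and upper left block `A`, where
`b = det(A)^{1/(α-1)}`, that is, `b` is an `(α-1)`-th root of `det A`. -/
def OrbChart.IsAdapted (c : OrbChart X (m + 1)) (D : Set X) (α : ℕ) : Prop :=
  ∃ ζ : CSpace (m + 1) → CSpace (m + 1),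
    DifferentiableOn ℂ ζ c.U ∧ Set.InjOn ζ c.U ∧
    (∀ z ∈ c.U, Function.Injective (fderiv ℂ ζ z)) ∧
    (∀ z ∈ c.U, c.proj z ∈ D ↔ ζ z (Fin.last m) = 0) ∧
    ∀ γ ∈ c.Γ, ∃ M : Matrix (Fin (m + 1)) (Fin (m + 1)) ℂ,
      (∀ j : Fin m, M (Fin.last m) j.castSucc = 0) ∧
      M (Fin.last m) (Fin.last m) ^ (α - 1) = (M.submatrix Fin.castSucc Fin.castSucc).det ∧
      ∀ z ∈ c.U, ζ (γ z) = M.mulVec (ζ z)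

/-- The basic assumption on the pair `(X, D)`. -/
def ComplexOrbifold.BasicAssumption (O : ComplexOrbifold X (m + 1)) (D : Set X) (α : ℕ) : Prop :=
  ∀ x ∈ D, ∃ c ∈ O.atlas, x ∈ c.range ∧ c.IsAdapted D α

/-- A holomorphic volume form `Ω` on `X \ D`: for each uniformising chart a nowhere vanishing
holomorphic `n`-form `φ^*Ω` on `Ũ \ D̃`, compatible with all injections. -/
structure HolVolForm (O : ComplexOrbifold X (m + 1)) (D : Set X) where
  /-- the form `φ^*Ω` in each chart -/
  form : O.atlas → CSpace (m + 1) → (CSpace (m + 1)) [⋀^Fin (m + 1)]→L[ℂ] ℂ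
  holo : ∀ c : O.atlas, DifferentiableOn ℂ (form c) (c.1.U \ c.1.pre D)
  ne_zero : ∀ c : O.atlas, ∀ z ∈ c.1.U \ c.1.pre D, form c z ≠ 0
  invariant : ∀ (c d : O.atlas) (f : CSpace (m + 1) → CSpace (m + 1)), IsInjection c.1 d.1 f →
    ∀ z ∈ c.1.U \ c.1.pre D,
      (form d (f z)).compContinuousLinearMap (fderiv ℂ f z) = form c z

/-- `Ω`, as a section of `K_X`, blows up to order `α` along `D`: if `s` is a local defining
function of `D̃`, then `s^α φ^*Ω` extends to a nowhere vanishing holomorphic `n`-form across `D̃`. -/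
def HolVolForm.BlowsUpToOrder {O : ComplexOrbifold X (m + 1)} {D : Set X} (Ω : HolVolForm O D)
    (α : ℕ) : Prop :=
  ∀ c : O.atlas, ∀ z ∈ c.1.pre D, ∃ V ⊆ c.1.U, IsOpen V ∧ z ∈ V ∧
    ∃ s, IsDefiningFunctionOn (c.1.pre D) V s ∧
      ∃ Ψ : CSpace (m + 1) → (CSpace (m + 1)) [⋀^Fin (m + 1)]→L[ℂ] ℂ,
        DifferentiableOn ℂ Ψ V ∧ (∀ w ∈ V, Ψ w ≠ 0) ∧
        ∀ w ∈ V \ c.1.pre D, s w ^ α • Ω.form c w = Ψ w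

/-- The value at `z ∈ D̃` of the holomorphic extension of `s^α φ^*Ω` to `Ũ`, where `s` is a defining
function of `D̃`. If `Ω` blows up to order `α`, the limit exists. -/
noncomputable def HolVolForm.clearedForm {O : ComplexOrbifold X (m + 1)} {D : Set X}
    (Ω : HolVolForm O D) (α : ℕ) (c : O.atlas) (s : CSpace (m + 1) → ℂ) (z : CSpace (m + 1)) :
    (CSpace (m + 1)) [⋀^Fin (m + 1)]→L[ℂ] ℂ :=
  Filter.limUnder (𝓝[c.1.U \ c.1.pre D] z) (fun w => s w ^ α • Ω.form c w)

/-! ### The total spaces `N_D \ {0}` and `K_D \ {0}` -/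

/-- The holomorphic tangent space `T_z S`: the vectors that are annihilated by the differentials of
all holomorphic germs at `z` vanishing on `S`. For a complex submanifold `S = {s = 0}` of
codimension one, this is the kernel of `ds`. -/
noncomputable def tangentTo {n : ℕ} (S : Set (CSpace n)) (z : CSpace n) :
    Submodule ℂ (CSpace n) :=
  ⨅ (f : CSpace n → ℂ) (_ : ∀ᶠ w in 𝓝 z, DifferentiableAt ℂ f w ∧ (w ∈ S → f w = 0)),
    LinearMap.ker (fderiv ℂ f z).toLinearMap

/-- The points of `N_D̃ \ {0}`: a point `z ∈ D̃` and a non-zero vector of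
`N_D̃|_z = T_z Ũ / T_z D̃`. -/
structure NormalPt (c : OrbChart X (m + 1)) (D : Set X) where
  pt : CSpace (m + 1)
  mem : pt ∈ c.pre D
  vec : CSpace (m + 1) ⧸ tangentTo (c.pre D) pt
  ne_zero : vec ≠ 0

/-- The point of `N_D̃ \ {0}` represented by `z ∈ D̃` and a vector `v` that is not tangent to
`D̃`. -/
noncomputable def NormalPt.ofVec {c : OrbChart X (m + 1)} {D : Set X}
    (p : {p : CSpace (m + 1) × CSpace (m + 1) //
      p.1 ∈ c.pre D ∧ p.2 ∉ tangentTo (c.pre D) p.1}) : NormalPt c D where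
  pt := p.1.1
  mem := p.2.1
  vec := Submodule.Quotient.mk p.1.2
  ne_zero := fun h => p.2.2 ((Submodule.Quotient.mk_eq_zero _).1 h)

/-- The topology of `N_D̃ \ {0}` as a quotient bundle of the trivial bundle `TŨ|_D̃`. -/
noncomputable instance (c : OrbChart X (m + 1)) (D : Set X) : TopologicalSpace (NormalPt c D) :=
  TopologicalSpace.coinduced NormalPt.ofVec inferInstance

/-- The points of `K_D̃ \ {0}`: a point `z ∈ D̃` and a non-zero alternating `(n-1)`-form on
`T_z D̃`. -/
structure CanonPt (c : OrbChart X (m + 1)) (D : Set X) where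
  pt : CSpace (m + 1)
  mem : pt ∈ c.pre D
  form : (tangentTo (c.pre D) pt) [⋀^Fin m]→L[ℂ] ℂ
  ne_zero : form ≠ 0

/-- The restriction of an `(n-1)`-form on `T_z Ũ` to `T_z D̃`. -/
noncomputable def restrictForm (c : OrbChart X (m + 1)) (D : Set X) (z : CSpace (m + 1))
    (η : (CSpace (m + 1)) [⋀^Fin m]→L[ℂ] ℂ) : (tangentTo (c.pre D) z) [⋀^Fin m]→L[ℂ] ℂ :=
  η.compContinuousLinearMap (tangentTo (c.pre D) z).subtypeL

/-- The point of `K_D̃ \ {0}` represented by `z ∈ D̃` and an `(n-1)`-form on `T_z Ũ` that does not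
vanish on `T_z D̃`. -/
noncomputable def CanonPt.ofForm {c : OrbChart X (m + 1)} {D : Set X}
    (p : {p : CSpace (m + 1) × (CSpace (m + 1)) [⋀^Fin m]→L[ℂ] ℂ //
      p.1 ∈ c.pre D ∧ restrictForm c D p.1 p.2 ≠ 0}) : CanonPt c D where
  pt := p.1.1
  mem := p.2.1
  form := restrictForm c D p.1.1 p.1.2
  ne_zero := p.2.2

/-- The topology of `K_D̃ \ {0}`, where `K_D̃` is regarded as a quotient bundle of the trivial bundle
`Λ^{n-1} T^*Ũ|_D̃`. -/
noncomputable instance (c : OrbChart X (m + 1)) (D : Set X) : TopologicalSpace (CanonPt c D) :=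
  TopologicalSpace.coinduced CanonPt.ofForm inferInstance

/-- The point `q` of `N_D̃' \ {0}` is the image of the point `p` of `N_D̃ \ {0}` under the map
`(z, [v]) ↦ (f(z), [df_z(v)])` induced by the injection `f`. -/
def NormalRel {D : Set X} {c d : OrbChart X (m + 1)} (f : CSpace (m + 1) → CSpace (m + 1))
    (p : NormalPt c D) (q : NormalPt d D) : Prop :=
  q.pt = f p.pt ∧ ∃ v : CSpace (m + 1),
    p.vec = Submodule.Quotient.mk v ∧ q.vec = Submodule.Quotient.mk (fderiv ℂ f p.pt v)

/-- The point `q` of `K_D̃' \ {0}` is the image of the point `p` of `K_D̃ \ {0}` under the map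
induced by the injection `f`: the form of `p` is the pullback under `f|_D̃` of the form of `q`. -/
def CanonRel {D : Set X} {c d : OrbChart X (m + 1)} (f : CSpace (m + 1) → CSpace (m + 1))
    (p : CanonPt c D) (q : CanonPt d D) : Prop :=
  q.pt = f p.pt ∧
    ∀ (u : Fin m → tangentTo (c.pre D) p.pt) (u' : Fin m → tangentTo (d.pre D) q.pt),
      (∀ i, (u' i : CSpace (m + 1)) = fderiv ℂ f p.pt (u i)) → q.form u' = p.form u

/-- Underlying space of the orbifold `N_D \ {0}`: the spaces `N_D̃ \ {0}` of all uniformising charts,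
glued along all injections (including the elements of the local uniformising groups). -/
def NormalTotal (O : ComplexOrbifold X (m + 1)) (D : Set X) : Type u :=
  Quot (fun p q : Σ c : O.atlas, NormalPt c.1 D =>
    ∃ f, IsInjection p.1.1 q.1.1 f ∧ NormalRel f p.2 q.2)

/-- Underlying space of the orbifold `K_D \ {0}`. -/
def CanonTotal (O : ComplexOrbifold X (m + 1)) (D : Set X) : Type u :=
  Quot (fun p q : Σ c : O.atlas, CanonPt c.1 D =>
    ∃ f, IsInjection p.1.1 q.1.1 f ∧ CanonRel f p.2 q.2)

noncomputable instance (O : ComplexOrbifold X (m + 1)) (D : Set X) : TopologicalSpace (NormalTotal O D) :=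
  inferInstanceAs (TopologicalSpace (Quot _))

noncomputable instance (O : ComplexOrbifold X (m + 1)) (D : Set X) :
    TopologicalSpace (CanonTotal O D) :=
  inferInstanceAs (TopologicalSpace (Quot _))

/-- The projection of the uniformising chart `N_D̃ \ {0}` of `N_D \ {0}`. -/
def NormalTotal.mk (O : ComplexOrbifold X (m + 1)) (D : Set X) (c : O.atlas)
    (p : NormalPt c.1 D) : NormalTotal O D := Quot.mk _ ⟨c, p⟩

/-- The projection of the uniformising chart `K_D̃ \ {0}` of `K_D \ {0}`. -/
def CanonTotal.mk (O : ComplexOrbifold X (m + 1)) (D : Set X) (c : O.atlas)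
    (p : CanonPt c.1 D) : CanonTotal O D := Quot.mk _ ⟨c, p⟩

/-! ### Orbifold maps from `N_D \ {0}` to `K_D \ {0}` -/

/-- A map of orbifolds `N_D \ {0} → K_D \ {0}`: a map of the underlying spaces together with lifts
`N_D̃ \ {0} → K_D̃ \ {0}` to the uniformising charts that are compatible with all injections; in
particular the lift to the chart with group `Γ` is `Γ`-equivariant. -/
structure NormalToCanonMap (O : ComplexOrbifold X (m + 1)) (D : Set X) where
  toFun : NormalTotal O D → CanonTotal O D
  lift : ∀ c : O.atlas, NormalPt c.1 D → CanonPt c.1 D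
  toFun_mk : ∀ (c : O.atlas) (p : NormalPt c.1 D),
    toFun (NormalTotal.mk O D c p) = CanonTotal.mk O D c (lift c p)
  compat : ∀ (c d : O.atlas) (f : CSpace (m + 1) → CSpace (m + 1)), IsInjection c.1 d.1 f →
    ∀ (p : NormalPt c.1 D) (q : NormalPt d.1 D),
      NormalRel f p q → CanonRel f (lift c p) (lift d q)

/-- The map is holomorphic: each lift `N_D̃ \ {0} → K_D̃ \ {0}` is holomorphic, which means that it
is locally induced by a holomorphic map `F` from an open set of `TŨ = Ũ × ℂⁿ` to
`Λ^{n-1} T^*Ũ ⊂ ℂⁿ × Λ^{n-1}(ℂⁿ)^*`. -/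
def NormalToCanonMap.IsHolomorphic {O : ComplexOrbifold X (m + 1)} {D : Set X}
    (φ : NormalToCanonMap O D) : Prop :=
  ∀ (c : O.atlas) (z v : CSpace (m + 1)), z ∈ c.1.pre D → v ∉ tangentTo (c.1.pre D) z →
    ∃ W : Set (CSpace (m + 1) × CSpace (m + 1)), IsOpen W ∧ (z, v) ∈ W ∧
      ∃ F : CSpace (m + 1) × CSpace (m + 1) →
          CSpace (m + 1) × (CSpace (m + 1)) [⋀^Fin m]→L[ℂ] ℂ,
        DifferentiableOn ℂ F W ∧
        ∀ p : {p : CSpace (m + 1) × CSpace (m + 1) //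
            p.1 ∈ c.1.pre D ∧ p.2 ∉ tangentTo (c.1.pre D) p.1}, p.1 ∈ W →
          ∃ h : (F p.1).1 ∈ c.1.pre D ∧ restrictForm c.1 D (F p.1).1 (F p.1).2 ≠ 0,
            φ.lift c (NormalPt.ofVec p) = CanonPt.ofForm ⟨F p.1, h⟩

/-- The map is an unbranched `k`-fold covering map of orbifolds: it is continuous and surjective,
and its equivariant lift to each uniformising chart is a covering map all of whose fibres have
exactly `k` points. -/
def NormalToCanonMap.IsUnbranchedCovering {O : ComplexOrbifold X (m + 1)} {D : Set X}
    (φ : NormalToCanonMap O D) (k : ℕ) : Prop :=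
  Continuous φ.toFun ∧ Function.Surjective φ.toFun ∧
    ∀ c : O.atlas, IsCoveringMap (φ.lift c) ∧ ∀ y, Nat.card (φ.lift c ⁻¹' {y}) = k

/-- In each uniformising chart with coordinates as in the basic assumption, and for each defining
function `s` of `D̃` on `Ũ`, the map is
`(z, λ ∂/∂s) ↦ (z, λ^{1-α} ((s^α φ^*Ω) ⌟ ∂/∂s)|_D̃)`. Here `∂/∂s` is the class in `N_D̃|_z` of any
vector `v` with `ds(v) = 1`. -/
def NormalToCanonMap.IsResidueMap {O : ComplexOrbifold X (m + 1)} {D : Set X}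
    (φ : NormalToCanonMap O D) (Ω : HolVolForm O D) (α : ℕ) : Prop :=
  ∀ c : O.atlas, c.1.IsAdapted D α →
    ∀ s : CSpace (m + 1) → ℂ, IsDefiningFunctionOn (c.1.pre D) c.1.U s →
      ∀ (p : NormalPt c.1 D) (v : CSpace (m + 1)) (lam : ℂ), lam ≠ 0 →
        fderiv ℂ s p.pt v = 1 → p.vec = lam • Submodule.Quotient.mk v →
        (φ.lift c p).pt = p.pt ∧
        ∀ u : Fin m → tangentTo (c.1.pre D) (φ.lift c p).pt,
          (φ.lift c p).form u = lam ^ (1 - (α : ℤ)) *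
            Ω.clearedForm α c s p.pt (Matrix.vecCons v (fun i => (u i : CSpace (m + 1))))

end Pair

/-! At a point `z` of `D̃`, let `s` be a local defining function, `Ψ` the value of the extension of
`s^α Ω`, and `v` a vector transverse to `D̃`. The map sends `v` to the restriction of `(ds v)^(-α) •
(Ψ ⌟ v)` to the tangent space of `D̃`. This form is intrinsic. Changing `v` by a tangent vector
changes the contraction by a top form evaluated on `m + 1` vectors of an `m`-dimensional space,
which is zero. If `dt = k ds` at `z`, then passing from `s` to `t` multiplies both `Ψ` and `(ds
v)^α` by `k^α` (`IsResidueData.residueForm_apply_eq`). Being intrinsic, it commutes with all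
injections (`residueLift_compat`) and so defines an orbifold map.

For `v = λ ∂/∂s` the factors `λ^(-α)` and `λ` combine to `λ^(1-α)`, which is the asserted formula.
In a local frame the lift becomes the power map `λ ↦ λ^(-(α-1))` on the fibres, so it is a pullback
of an `(α-1)`-sheeted covering of the punctured line (`IsLocalFrame.isCoveringMap_restrict`).

Uniqueness: the formula fixes the lifts in adapted charts, and these cover `D`. Any other chart is
joined to an adapted one by a roof of injections, along which a compatible lift is determined.

Existence of `Ω`: where `D` is cut out by `s c` and the isomorphism is `θ c`, take `θ c * (s c)^(-α)
dz₁ ∧ ⋯ ∧ dzₙ`. The intertwining identity for `θ` is exactly invariance under injections. These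
forms live on a subatlas only; they are carried to every chart by germs of transition maps. The
result is well defined off `D` because isotropy is trivial there, so a transition germ is determined
by its value at the base point. -/

/-! ### Regularity of holomorphic functions of several variables -/

section Holomorphic

open Metric MeasureTheory

variable {E F : Type u} [NormedAddCommGroup E] [NormedSpace ℂ E] [FiniteDimensional ℂ E]
  [NormedAddCommGroup F] [NormedSpace ℂ F] [FiniteDimensional ℂ F]

/-- Directional derivatives of a holomorphic function of several variables are holomorphic. -/
theorem differentiableAt_fderiv_apply_of_isOpen {f : E → F} {U : Set E} (hU : IsOpen U)
    (hf : DifferentiableOn ℂ f U) {z : E} (hz : z ∈ U) (v : E) :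
    DifferentiableAt ℂ (fun w => fderiv ℂ f w v) z := by
  have : CompleteSpace F := FiniteDimensional.complete ℂ F
  have : ProperSpace E := FiniteDimensional.proper ℂ E
  have : ProperSpace F := FiniteDimensional.proper ℂ F
  have : ProperSpace (E →L[ℂ] F) := FiniteDimensional.proper ℂ _
  have hcz : ∀ᶠ w in 𝓝 z, w ∈ U ∧ dist (f w) (f z) < 1 :=
    (hU.eventually_mem hz).and ((hf.differentiableAt (hU.mem_nhds hz)).continuousAt.eventually
      (ball_mem_nhds _ one_pos))
  obtain ⟨ε, hε, hball⟩ := Metric.eventually_nhds_iff_ball.1 hcz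
  -- The radius `ε` is spent in thirds: one for the base point, one for the disc in direction `v`,
  -- one for the Cauchy estimate of the derivative.
  obtain ⟨r, hr, hrv⟩ : ∃ r > 0, r * ‖v‖ < ε / 3 := by
    refine ⟨ε / 3 / (‖v‖ + 1), by positivity, ?_⟩
    rw [div_mul_eq_mul_div, div_lt_iff₀ (by positivity)]
    nlinarith [norm_nonneg v]
  have hnear : ∀ w ∈ ball z (ε / 3), ∀ ζ : ℂ, ‖ζ‖ ≤ r → w + ζ • v ∈ ball z (2 * ε / 3) := by
    intro w hw ζ hζ
    rw [mem_ball, dist_eq_norm] at hw ⊢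
    calc ‖w + ζ • v - z‖ = ‖(w - z) + ζ • v‖ := by congr 1; abel
      _ ≤ ‖w - z‖ + ‖ζ‖ * ‖v‖ := (norm_add_le _ _).trans (by rw [norm_smul])
      _ ≤ ‖w - z‖ + r * ‖v‖ := by gcongr
      _ < 2 * ε / 3 := by linarith
  have hdiff : ∀ y ∈ ball z (2 * ε / 3), DifferentiableAt ℂ f y := fun y hy =>
    hf.differentiableAt (hU.mem_nhds (hball y (ball_subset_ball (by linarith) hy)).1)
  have hbound : ∀ y ∈ ball z (2 * ε / 3), ‖fderiv ℂ f y‖ ≤ 2 / (ε / 3) := by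
    intro y hy
    have hsub : ball y (ε / 3) ⊆ ball z ε := ball_subset_ball' (by
      rw [mem_ball] at hy; linarith)
    refine Complex.norm_fderiv_le_div_of_mapsTo_ball (fun w hw => (hf.differentiableAt
      (hU.mem_nhds (hball w (hsub hw)).1)).differentiableWithinAt) ?_ (by positivity)
    intro w hw
    have h1 := (hball w (hsub hw)).2
    have h2 := (hball y (hsub (mem_ball_self (by positivity)))).2
    rw [mem_closedBall]
    linarith [dist_triangle_right (f w) (f y) (f z)]
  -- Cauchy's formula on the complex line in direction `v` writes the derivative as an integral of
  -- `f` itself, which can be differentiated in `w` under the integral sign.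
  have hCauchy : ∀ w ∈ ball z (ε / 3), fderiv ℂ f w v = (2 * Real.pi * Complex.I)⁻¹ •
      ∮ ζ in C(0, r), (1 / (ζ - 0) ^ 2) • f (w + ζ • v) := by
    intro w hw
    have hline : ∀ ζ : ℂ, HasDerivAt (fun ζ : ℂ => w + ζ • v) v ζ := fun ζ => by
      simpa using ((hasDerivAt_id ζ).smul_const v).const_add w
    have hd : DifferentiableOn ℂ (fun ζ : ℂ => f (w + ζ • v)) (closedBall 0 r) := fun ζ hζ =>
      ((hdiff _ (hnear w hw ζ (by simpa using hζ))).comp ζ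
        (hline ζ).differentiableAt).differentiableWithinAt
    rw [hd.deriv_eq_smul_circleIntegral hr, smul_smul,
      inv_mul_cancel₀ Complex.two_pi_I_ne_zero, one_smul]
    have h0 : HasFDerivAt f (fderiv ℂ f (w + (0 : ℂ) • v)) (w + (0 : ℂ) • v) :=
      (hdiff _ (hnear w hw 0 (by simpa using hr.le))).hasFDerivAt
    have := (h0.comp_hasDerivAt (0 : ℂ) (hline 0)).deriv
    simpa [Function.comp_def] using this.symm
  have hev : (fun w => fderiv ℂ f w v) =ᶠ[𝓝 z] fun w => (2 * Real.pi * Complex.I)⁻¹ •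
      ∮ ζ in C(0, r), (1 / (ζ - 0) ^ 2) • f (w + ζ • v) := by
    filter_upwards [ball_mem_nhds z (by positivity : 0 < ε / 3)] with w hw using hCauchy w hw
  refine DifferentiableAt.congr_of_eventuallyEq ?_ hev
  refine DifferentiableAt.const_smul ?_ _
  set k : ℝ → ℂ := fun θ => deriv (circleMap 0 r) θ * (1 / (circleMap 0 r θ - 0) ^ 2) with hk
  have hkc : Continuous k := by
    have h0 : ∀ θ, (circleMap 0 r θ - 0) ^ 2 ≠ 0 := fun θ => by
      simpa using hr.ne'
    have : Continuous (deriv (circleMap 0 r)) := by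
      rw [show deriv (circleMap 0 r) = fun θ => circleMap 0 r θ * Complex.I from funext fun θ => by simp]
      fun_prop
    exact this.mul (continuous_const.div (by fun_prop) h0)
  have hcirc : ∀ θ : ℝ, ‖circleMap 0 r θ‖ ≤ r := fun θ => by simp [abs_of_pos hr]
  have hcont : ∀ w ∈ ball z (ε / 3), Continuous fun θ : ℝ => k θ • f (w + circleMap 0 r θ • v) := by
    intro w hw
    refine hkc.smul (continuous_iff_continuousAt.2 fun θ => ?_)
    have h1 : ContinuousAt f (w + circleMap 0 r θ • v) :=
      (hdiff _ (hnear w hw _ (hcirc θ))).continuousAt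
    have h2 : ContinuousAt (fun θ : ℝ => w + circleMap 0 r θ • v) θ := by fun_prop
    exact ContinuousAt.comp (f := fun θ : ℝ => w + circleMap 0 r θ • v) h1 h2
  have key := intervalIntegral.hasFDerivAt_integral_of_dominated_of_fderiv_le (𝕜 := ℂ)
    (μ := volume) (a := 0) (b := 2 * Real.pi) (s := ball z (ε / 3))
    (F := fun w θ => k θ • f (w + circleMap 0 r θ • v))
    (F' := fun w θ => k θ • fderiv ℂ f (w + circleMap 0 r θ • v)) (x₀ := z)
    (bound := fun θ => ‖k θ‖ * (2 / (ε / 3)))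
    (ball_mem_nhds z (by positivity))
    (by
      filter_upwards [ball_mem_nhds z (by positivity : 0 < ε / 3)] with w hw
      exact (hcont w hw).aestronglyMeasurable)
    ((hcont z (mem_ball_self (by positivity))).intervalIntegrable _ _)
    (by
      borelize E
      borelize F
      borelize (E →L[ℂ] F)
      -- Continuity of the derivative is not yet known here, but a derivative is always measurable.
      have h1 : Measurable fun θ : ℝ => fderiv ℂ f (z + circleMap 0 r θ • v) :=
        (measurable_fderiv ℂ f).comp
          (by fun_prop : Continuous fun θ : ℝ => z + circleMap 0 r θ • v).measurable
      exact hkc.aestronglyMeasurable.smul h1.aestronglyMeasurable)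
    (by
      refine Filter.Eventually.of_forall fun θ _ w hw => ?_
      rw [norm_smul]
      gcongr
      exact hbound _ (hnear w hw _ (hcirc θ)))
    ((hkc.norm.mul continuous_const).intervalIntegrable _ _)
    (by
      refine Filter.Eventually.of_forall fun θ _ w hw => ?_
      have h1 := (hdiff _ (hnear w hw _ (hcirc θ))).hasFDerivAt
      have h2 : HasFDerivAt (fun w : E => w + circleMap 0 r θ • v) (ContinuousLinearMap.id ℂ E) w :=
        (hasFDerivAt_id w).add_const _
      simpa using! (h1.comp w h2).const_smul (k θ))
  have heq : (fun w => ∮ ζ in C(0, r), (1 / (ζ - 0) ^ 2) • f (w + ζ • v)) =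
      fun w => ∫ θ in (0 : ℝ)..2 * Real.pi, k θ • f (w + circleMap 0 r θ • v) := by
    funext w
    simp only [circleIntegral, hk, smul_smul]
  rw [heq]
  exact key.differentiableAt

/-- The derivative of a holomorphic function of several variables is holomorphic. -/
theorem differentiableOn_fderiv_of_isOpen {f : E → F} {U : Set E} (hU : IsOpen U)
    (hf : DifferentiableOn ℂ f U) : DifferentiableOn ℂ (fderiv ℂ f) U := by
  have h : ∀ v, DifferentiableOn ℂ (fun w => fderiv ℂ f w v) U := fun v z hz =>
    (differentiableAt_fderiv_apply_of_isOpen hU hf hz v).differentiableWithinAt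
  -- Evaluation on a basis identifies linear maps with tuples of vectors, so directional holomorphy
  -- suffices.
  let e := ContinuousLinearEquiv.ofFinrankEq
    (Module.finrank_fin_fun ℂ (n := Module.finrank ℂ E)).symm
  let e₂ := (e.arrowCongr (ContinuousLinearEquiv.refl ℂ F)).trans
    (ContinuousLinearEquiv.piRing (Fin (Module.finrank ℂ E)))
  have h2 : DifferentiableOn ℂ (fun w => e₂ (fderiv ℂ f w)) U := by
    rw [differentiableOn_pi]
    intro i
    exact h _
  exact (e₂.comp_differentiableOn_iff).1 h2

/-- Holomorphic functions of several variables are smooth. -/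
theorem contDiffOn_of_isOpen_of_differentiableOn {f : E → F} {U : Set E} (hU : IsOpen U)
    (hf : DifferentiableOn ℂ f U) (n : ℕ) : ContDiffOn ℂ n f U := by
  induction n generalizing F with
  | zero => exact contDiffOn_zero.2 hf.continuousOn
  | succ n ih =>
    rw [Nat.cast_succ, contDiffOn_succ_iff_fderiv_of_isOpen hU]
    exact ⟨hf, by simp, ih (differentiableOn_fderiv_of_isOpen hU hf)⟩

theorem contDiffAt_of_eventually_differentiableAt {f : E → F} {z : E}
    (h : ∀ᶠ w in 𝓝 z, DifferentiableAt ℂ f w) (n : ℕ) : ContDiffAt ℂ n f z := by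
  obtain ⟨V, hd, hV, hz⟩ := _root_.eventually_nhds_iff.1 h
  replace hd : DifferentiableOn ℂ f V := fun w hw => (hd w hw).differentiableWithinAt
  exact (contDiffOn_of_isOpen_of_differentiableOn hV hd n).contDiffAt (hV.mem_nhds hz)

theorem differentiableAt_fderiv_of_eventually {f : E → F} {z : E}
    (h : ∀ᶠ w in 𝓝 z, DifferentiableAt ℂ f w) : DifferentiableAt ℂ (fderiv ℂ f) z := by
  obtain ⟨V, hd, hV, hz⟩ := _root_.eventually_nhds_iff.1 h
  replace hd : DifferentiableOn ℂ f V := fun w hw => (hd w hw).differentiableWithinAt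
  exact (differentiableOn_fderiv_of_isOpen hV hd).differentiableAt (hV.mem_nhds hz)

theorem hasStrictFDerivAt_of_eventually {f : E → F} {z : E}
    (h : ∀ᶠ w in 𝓝 z, DifferentiableAt ℂ f w) : HasStrictFDerivAt f (fderiv ℂ f z) z :=
  (contDiffAt_of_eventually_differentiableAt h 1).hasStrictFDerivAt (by simp)

end Holomorphic

/-! ### Defining functions of smooth hypersurfaces, compared to first order -/

section LocalDefining

open Asymptotics Filter

variable {n : ℕ} {S : Set (CSpace n)} {s t f : CSpace n → ℂ} {z : CSpace n}

/-- `s` is a holomorphic defining function of the germ of the smooth hypersurface `S` at its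
point `z`. -/
structure IsLocalDefining (S : Set (CSpace n)) (s : CSpace n → ℂ) (z : CSpace n) : Prop where
  mem : z ∈ S
  holo : ∀ᶠ w in 𝓝 z, DifferentiableAt ℂ s w
  zero_iff : ∀ᶠ w in 𝓝 z, s w = 0 ↔ w ∈ S
  deriv_ne : fderiv ℂ s z ≠ 0

theorem IsDefiningFunctionOn.isLocalDefining {V : Set (CSpace n)}
    (hs : IsDefiningFunctionOn S V s) (hV : IsOpen V) (hz : z ∈ V) (hzS : z ∈ S) :
    IsLocalDefining S s z where
  mem := hzS
  holo := by
    filter_upwards [hV.mem_nhds hz] with w hw using hs.holo.differentiableAt (hV.mem_nhds hw)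
  zero_iff := by filter_upwards [hV.mem_nhds hz] with w hw using hs.zero_iff w hw
  deriv_ne := hs.deriv_ne z hz hzS

theorem exists_apply_eq_one {ℓ : CSpace n →L[ℂ] ℂ} (h : ℓ ≠ 0) : ∃ v, ℓ v = 1 := by
  obtain ⟨w, hw⟩ : ∃ w, ℓ w ≠ 0 := by
    by_contra! h'
    exact h (ContinuousLinearMap.ext h')
  exact ⟨(ℓ w)⁻¹ • w, by simp [hw]⟩

theorem IsLocalDefining.apply_eq_zero (hs : IsLocalDefining S s z) : s z = 0 :=
  hs.zero_iff.self_of_nhds.2 hs.mem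

/-- A holomorphic function vanishing on a smooth hypersurface is, to first order, a multiple of the
defining function. -/
theorem IsLocalDefining.exists_isLittleO (hs : IsLocalDefining S s z)
    (hf : ∀ᶠ w in 𝓝 z, DifferentiableAt ℂ f w) (hfS : ∀ᶠ w in 𝓝 z, w ∈ S → f w = 0) :
    ∃ k : ℂ, (fun w => f w - k * s w) =o[𝓝 z] s ∧ fderiv ℂ f z = k • fderiv ℂ s z := by
  set ℓ := fderiv ℂ s z with hℓ
  obtain ⟨v, hv⟩ : ∃ v, ℓ v = 1 := exists_apply_eq_one hs.deriv_ne
  have hss : HasStrictFDerivAt s ℓ z := hasStrictFDerivAt_of_eventually hs.holo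
  have hfs : HasStrictFDerivAt f (fderiv ℂ f z) z := hasStrictFDerivAt_of_eventually hf
  have hsc : Tendsto s (𝓝 z) (𝓝 0) := by
    simpa [hs.apply_eq_zero] using hss.hasFDerivAt.continuousAt.tendsto
  -- Since `ℓ v = 1`, `ℓ (Φ w) = s w`: this local diffeomorphism straightens `S` to a hyperplane and
  -- moves points only along `v`. Below, `w₀ w` is the projection of `w` to `S` along `v`.
  let Φ : CSpace n → CSpace n := fun w => w + (s w - ℓ w) • v
  have hΦ : HasStrictFDerivAt Φ ((ContinuousLinearEquiv.refl ℂ (CSpace n) :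
      CSpace n ≃L[ℂ] CSpace n) : CSpace n →L[ℂ] CSpace n) z := by
    have h : HasStrictFDerivAt Φ (ContinuousLinearMap.id ℂ (CSpace n) + (ℓ - ℓ).smulRight v) z :=
      (hasStrictFDerivAt_id (𝕜 := ℂ) z).add ((hss.sub ℓ.hasStrictFDerivAt).smul_const v)
    rw [sub_self, ContinuousLinearMap.zero_smulRight, add_zero] at h
    exact h
  let Ψ := hΦ.localInverse Φ _ z
  have hbase : Tendsto (fun w => Φ w - s w • v) (𝓝 z) (𝓝 (Φ z)) := by
    simpa using hΦ.hasFDerivAt.continuousAt.tendsto.sub (hsc.smul_const v)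
  let w₀ : CSpace n → CSpace n := fun w => Ψ (Φ w - s w • v)
  have hw₀ : Tendsto w₀ (𝓝 z) (𝓝 z) := hΦ.localInverse_tendsto.comp hbase
  have hright : ∀ᶠ w in 𝓝 z, Φ (w₀ w) = Φ w - s w • v :=
    hbase.eventually hΦ.eventually_right_inverse
  have hs₀ : ∀ᶠ w in 𝓝 z, s (w₀ w) = 0 := by
    filter_upwards [hright] with w hw
    have := congrArg ℓ hw
    simp only [Φ, map_add, map_sub, map_smul, smul_eq_mul, hv, mul_one] at this
    linear_combination this
  have hf₀ : ∀ᶠ w in 𝓝 z, f (w₀ w) = 0 := by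
    filter_upwards [hs₀, hw₀.eventually hs.zero_iff, hw₀.eventually hfS] with w h1 h2 h3
      using h3 (h2.1 h1)
  let τ : CSpace n → ℂ := fun w => ℓ (w - w₀ w)
  have hτ : ∀ᶠ w in 𝓝 z, w - w₀ w = τ w • v := by
    filter_upwards [hright, hs₀] with w h1 h2
    simp only [Φ, h2, zero_sub] at h1
    have : w - w₀ w = (ℓ w - ℓ (w₀ w)) • v := by
      have h3 : w₀ w = w + (s w - ℓ w) • v - s w • v + ℓ (w₀ w) • v := by
        rw [← h1]; simp
      rw [sub_eq_iff_eq_add, sub_smul]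
      nth_rewrite 2 [h3]
      module
    simpa [τ, map_sub] using this
  have hpair : Tendsto (fun w => (w, w₀ w)) (𝓝 z) (𝓝 (z, z)) := by
    rw [nhds_prod_eq]; exact tendsto_id.prodMk hw₀
  have hO : (fun w => w - w₀ w) =O[𝓝 z] τ := by
    refine IsBigO.of_bound ‖v‖ ?_
    filter_upwards [hτ] with w hw
    rw [hw, norm_smul, mul_comm]
  -- Strict differentiability at `z` applies to the pair `(w, w₀ w)`, both of whose points move. As
  -- `s` and `f` vanish at `w₀ w`, it yields their leading terms in `τ`.
  have hsτ : (fun w => s w - τ w) =o[𝓝 z] τ := by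
    refine (((hss.isLittleO.comp_tendsto hpair).trans_isBigO hO).congr' ?_ .rfl)
    filter_upwards [hs₀] with w hw
    simp [τ, hw]
  have hfτ : (fun w => f w - fderiv ℂ f z v * τ w) =o[𝓝 z] τ := by
    refine (((hfs.isLittleO.comp_tendsto hpair).trans_isBigO hO).congr' ?_ .rfl)
    filter_upwards [hf₀, hτ] with w hw h2
    simp only [Function.comp_apply, hw, h2, map_smul, smul_eq_mul]
    ring
  have hτs : τ =O[𝓝 z] s := (IsEquivalent.symm (show s ~[𝓝 z] τ from hsτ)).isBigO
  refine ⟨fderiv ℂ f z v, ?_, ?_⟩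
  · refine IsLittleO.trans_isBigO ?_ hτs
    refine (hfτ.sub (hsτ.const_mul_left (fderiv ℂ f z v))).congr_left fun w => ?_
    ring
  · have hlit : (fun w => f w - fderiv ℂ f z v * s w) =o[𝓝 z] s := by
      refine IsLittleO.trans_isBigO ?_ hτs
      refine (hfτ.sub (hsτ.const_mul_left (fderiv ℂ f z v))).congr_left fun w => ?_
      ring
    have hsO : s =O[𝓝 z] fun w => w - z := by
      simpa [hs.apply_eq_zero] using hss.hasFDerivAt.isBigO_sub
    have hfz : f z = 0 := hfS.self_of_nhds hs.mem
    -- The difference is `o(s)` and `s = O(w - z)`, so its derivative at `z` vanishes.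
    have h0 : HasFDerivAt (fun w => f w - fderiv ℂ f z v * s w) (0 : CSpace n →L[ℂ] ℂ) z := by
      rw [hasFDerivAt_iff_isLittleO]
      simpa [hfz, hs.apply_eq_zero] using hlit.trans_isBigO hsO
    have h1 : HasFDerivAt (fun w => f w - fderiv ℂ f z v * s w)
        (fderiv ℂ f z - fderiv ℂ f z v • ℓ) z :=
      hfs.hasFDerivAt.sub (hss.hasFDerivAt.const_mul _)
    exact sub_eq_zero.1 (h1.unique h0)

/-- Every differential in the infimum is a multiple of `ds`, and `s` is itself one of the competing
germs. -/
theorem IsLocalDefining.tangentTo_eq (hs : IsLocalDefining S s z) :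
    tangentTo S z = LinearMap.ker (fderiv ℂ s z).toLinearMap := by
  refine le_antisymm (iInf₂_le s (hs.holo.and ?_)) (le_iInf₂ fun f hf u hu => ?_)
  · filter_upwards [hs.zero_iff] with w hw using hw.2
  · obtain ⟨k, -, hk⟩ := hs.exists_isLittleO (hf.mono fun _ h => h.1) (hf.mono fun _ h => h.2)
    have hu' : fderiv ℂ s z u = 0 := hu
    simp [LinearMap.mem_ker, hk, hu']

theorem IsLocalDefining.mem_tangentTo (hs : IsLocalDefining S s z) {v : CSpace n} :
    v ∈ tangentTo S z ↔ fderiv ℂ s z v = 0 := by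
  rw [hs.tangentTo_eq]; rfl

/-- Otherwise `s` would vanish near `z`, contradicting `ds ≠ 0`. Hence limits taken off the
hypersurface are unique. -/
theorem IsLocalDefining.neBot (hs : IsLocalDefining S s z) {U : Set (CSpace n)} (hU : U ∈ 𝓝 z) :
    (𝓝[U \ S] z).NeBot := by
  rw [← mem_closure_iff_nhdsWithin_neBot, mem_closure_iff_frequently]
  intro h
  refine hs.deriv_ne ?_
  have : s =ᶠ[𝓝 z] fun _ => 0 := by
    filter_upwards [h, hs.zero_iff, hU] with w h1 h2 h3
    exact h2.2 (by_contra fun h4 => h1 ⟨h3, h4⟩)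
  rw [this.fderiv_eq]
  simp

/-- Two defining functions differ by a non-vanishing factor. -/
theorem IsLocalDefining.exists_ratio (hs : IsLocalDefining S s z) (ht : IsLocalDefining S t z)
    (U : Set (CSpace n)) :
    ∃ k : ℂ, k ≠ 0 ∧ fderiv ℂ t z = k • fderiv ℂ s z ∧
      Tendsto (fun w => t w / s w) (𝓝[U \ S] z) (𝓝 k) := by
  obtain ⟨k, h1, h2⟩ := hs.exists_isLittleO ht.holo (ht.zero_iff.mono fun _ h => h.2)
  refine ⟨k, ?_, h2, ?_⟩
  · rintro rfl
    exact ht.deriv_ne (ContinuousLinearMap.ext fun x => by simp [h2])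
  · have h3 := (h1.mono (nhdsWithin_le_nhds (s := U \ S))).tendsto_div_nhds_zero
    have h4 := h3.add_const k
    rw [zero_add] at h4
    refine h4.congr' ?_
    filter_upwards [self_mem_nhdsWithin, nhdsWithin_le_nhds hs.zero_iff] with w hw hsw
    have : s w ≠ 0 := fun h => hw.2 (hsw.1 h)
    field_simp
    ring

end LocalDefining

/-! ### Top degree forms and hyperplanes -/

section Alternating

variable {m : ℕ} {ℓ : CSpace (m + 1) →L[ℂ] ℂ} {v : CSpace (m + 1)}
  {Ψ : (CSpace (m + 1)) [⋀^Fin (m + 1)]→L[ℂ] ℂ}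

theorem finrank_ker_eq (hℓ : ℓ ≠ 0) : Module.finrank ℂ (LinearMap.ker ℓ.toLinearMap) = m := by
  have h := Module.Dual.finrank_ker_add_one_of_ne_zero (f := ℓ.toLinearMap)
    (fun h => hℓ (ContinuousLinearMap.coe_injective h))
  simpa using h

/-- A basis of the hyperplane together with a transverse vector is a basis of the whole space, and a
non-zero top form does not vanish on a basis. -/
theorem alternating_vecCons_ne_zero (hΨ : Ψ ≠ 0) (hv : ℓ v ≠ 0) {u : Fin m → CSpace (m + 1)}
    (hu : ∀ i, ℓ (u i) = 0) (hli : LinearIndependent ℂ u) : Ψ (Matrix.vecCons v u) ≠ 0 := by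
  have hli' : LinearIndependent ℂ (Matrix.vecCons v u : Fin (m + 1) → CSpace (m + 1)) := by
    refine linearIndependent_finCons.2 ⟨hli, fun hmem => hv ?_⟩
    have : Submodule.span ℂ (Set.range u) ≤ LinearMap.ker ℓ.toLinearMap := by
      rw [Submodule.span_le]; rintro _ ⟨i, rfl⟩; exact hu i
    exact this hmem
  let b := basisOfLinearIndependentOfCardEqFinrank hli' (by simp)
  have hb : (b : Fin (m + 1) → CSpace (m + 1)) = Matrix.vecCons v u :=
    coe_basisOfLinearIndependentOfCardEqFinrank _ _
  intro h0
  have := (AlternatingMap.map_basis_eq_zero_iff b Ψ.toAlternatingMap).1 (by rw [hb]; exact h0)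
  exact hΨ (ContinuousAlternatingMap.toAlternatingMap_injective this)

/-- The hyperplane has dimension `m`, so `m + 1` vectors in it are dependent. -/
theorem alternating_vecCons_eq_zero (hℓ : ℓ ≠ 0) {u : Fin (m + 1) → CSpace (m + 1)}
    (hu : ∀ i, ℓ (u i) = 0) : Ψ u = 0 := by
  refine Ψ.toAlternatingMap.map_linearDependent u fun hli => ?_
  have h1 : LinearIndependent ℂ (fun i => (⟨u i, hu i⟩ : LinearMap.ker ℓ.toLinearMap)) :=
    LinearIndependent.of_comp (LinearMap.ker ℓ.toLinearMap).subtype hli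
  have := h1.fintype_card_le_finrank
  rw [finrank_ker_eq hℓ] at this
  simp at this

theorem exists_linearIndependent_ker (hℓ : ℓ ≠ 0) :
    ∃ u : Fin m → CSpace (m + 1), (∀ i, ℓ (u i) = 0) ∧ LinearIndependent ℂ u := by
  let b := Module.finBasisOfFinrankEq ℂ (LinearMap.ker ℓ.toLinearMap) (finrank_ker_eq hℓ)
  refine ⟨fun i => (b i : CSpace (m + 1)), fun i => LinearMap.mem_ker.1 (b i).2, ?_⟩
  exact b.linearIndependent.map' (LinearMap.ker ℓ.toLinearMap).subtype (Submodule.ker_subtype _)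

/-- Top degree forms on a hyperplane that agree on one linearly independent family are equal. -/
theorem alternating_ext_of_linearIndependent {T : Submodule ℂ (CSpace (m + 1))}
    (hT : Module.finrank ℂ T = m) {η η' : T [⋀^Fin m]→L[ℂ] ℂ} {u : Fin m → T}
    (hu : LinearIndependent ℂ u) (h : η u = η' u) : η = η' := by
  let b := basisOfLinearIndependentOfCardEqFinrank' u hu (by simp [hT])
  have hb : (b : Fin m → T) = u := coe_basisOfLinearIndependentOfCardEqFinrank' _ _ _
  have := (AlternatingMap.map_basis_eq_zero_iff b (η - η').toAlternatingMap).1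
    (by rw [hb]; simp [h])
  exact sub_eq_zero.1 (ContinuousAlternatingMap.toAlternatingMap_injective this)

end Alternating

/-! ### Injections of charts as local biholomorphisms -/

section Injection

open Filter

variable {X : Type u} [TopologicalSpace X] {n : ℕ} {c d : OrbChart X n} {f : CSpace n → CSpace n}
  {D : Set X} {z : CSpace n}

theorem IsInjection.eventually_differentiableAt (hf : IsInjection c d f) (hz : z ∈ c.U) :
    ∀ᶠ w in 𝓝 z, DifferentiableAt ℂ f w := by
  filter_upwards [c.isOpen_U.mem_nhds hz] with w hw
    using hf.holo.differentiableAt (c.isOpen_U.mem_nhds hw)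

theorem IsInjection.differentiableAt (hf : IsInjection c d f) (hz : z ∈ c.U) :
    DifferentiableAt ℂ f z := (hf.eventually_differentiableAt hz).self_of_nhds

theorem IsInjection.mem_pre_iff (hf : IsInjection c d f) (hz : z ∈ c.U) :
    f z ∈ d.pre D ↔ z ∈ c.pre D := by
  simp [OrbChart.pre, hz, hf.mapsTo hz, hf.proj_comp z hz]

theorem IsInjection.tendsto_diff (hf : IsInjection c d f) (hz : z ∈ c.U) :
    Tendsto f (𝓝[c.U \ c.pre D] z) (𝓝[d.U \ d.pre D] (f z)) := by
  refine tendsto_nhdsWithin_iff.2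
    ⟨(hf.differentiableAt hz).continuousAt.tendsto.mono_left nhdsWithin_le_nhds, ?_⟩
  filter_upwards [self_mem_nhdsWithin] with w hw
  exact ⟨hf.mapsTo hw.1, fun h => hw.2 ((hf.mem_pre_iff hw.1).1 h)⟩

theorem surjective_of_injective_clm {L : CSpace n →L[ℂ] CSpace n} (h : Function.Injective L) :
    Function.Surjective L :=
  LinearMap.injective_iff_surjective (f := L.toLinearMap).1 h

theorem IsInjection.surjective_fderiv (hf : IsInjection c d f) (hz : z ∈ c.U) :
    Function.Surjective (fderiv ℂ f z) := surjective_of_injective_clm (hf.immersion z hz)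

/-- The pullback of a local defining function under a local biholomorphism. -/
theorem IsLocalDefining.comp {S T : Set (CSpace n)} {s : CSpace n → ℂ}
    (hs : IsLocalDefining S s (f z)) (hf : ∀ᶠ w in 𝓝 z, DifferentiableAt ℂ f w)
    (hinj : Function.Injective (fderiv ℂ f z)) (hST : ∀ᶠ w in 𝓝 z, f w ∈ S ↔ w ∈ T) :
    IsLocalDefining T (s ∘ f) z where
  mem := hST.self_of_nhds.1 hs.mem
  holo := by
    filter_upwards [hf.self_of_nhds.continuousAt.eventually hs.holo, hf] with w h1 h2
      using h1.comp w h2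
  zero_iff := by
    filter_upwards [hf.self_of_nhds.continuousAt.eventually hs.zero_iff, hST] with w h1 h2
      using h1.trans h2
  deriv_ne := by
    rw [fderiv_comp z hs.holo.self_of_nhds hf.self_of_nhds]
    intro h
    refine hs.deriv_ne (ContinuousLinearMap.ext fun v => ?_)
    obtain ⟨w, rfl⟩ := surjective_of_injective_clm hinj v
    simpa using DFunLike.congr_fun h w

end Injection

/-! ### The residue form and its invariance -/

section Residue

open Filter

variable {X : Type u} [TopologicalSpace X] {m : ℕ} {O : ComplexOrbifold X (m + 1)} {D : Set X}
  {Ω : HolVolForm O D} {α : ℕ} {c d : O.atlas} {z : CSpace (m + 1)} {s t : CSpace (m + 1) → ℂ}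
  {Ψ Ψ' : (CSpace (m + 1)) [⋀^Fin (m + 1)]→L[ℂ] ℂ}

/-- `s` is a local defining function of `D̃` at `z`, and `Ψ ≠ 0` is the value at `z` of the
extension of `s ^ α • Ω`. -/
structure IsResidueData (Ω : HolVolForm O D) (α : ℕ) (c : O.atlas) (z : CSpace (m + 1))
    (s : CSpace (m + 1) → ℂ) (Ψ : (CSpace (m + 1)) [⋀^Fin (m + 1)]→L[ℂ] ℂ) : Prop where
  loc : IsLocalDefining (c.1.pre D) s z
  tendsto : Tendsto (fun w => s w ^ α • Ω.form c w) (𝓝[c.1.U \ c.1.pre D] z) (𝓝 Ψ)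
  ne_zero : Ψ ≠ 0

/-- One pair `s`, `Ψ` serves all points of `D̃` in `V`; this uniformity gives holomorphic and
continuous dependence on the base point. -/
theorem HolVolForm.BlowsUpToOrder.exists_residueData (hΩ : Ω.BlowsUpToOrder α)
    (hz : z ∈ c.1.pre D) :
    ∃ V ⊆ c.1.U, IsOpen V ∧ z ∈ V ∧ ∃ s, DifferentiableOn ℂ s V ∧
      ∃ Ψ : CSpace (m + 1) → (CSpace (m + 1)) [⋀^Fin (m + 1)]→L[ℂ] ℂ, DifferentiableOn ℂ Ψ V ∧
        ∀ w ∈ V, w ∈ c.1.pre D → IsResidueData Ω α c w s (Ψ w) := by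
  obtain ⟨V, hVU, hV, hzV, s, hs, Ψ, hΨ, hΨ0, h⟩ := hΩ c z hz
  refine ⟨V, hVU, hV, hzV, s, hs.holo, Ψ, hΨ, fun w hw hwD =>
    ⟨hs.isLocalDefining hV hw hwD, ?_, hΨ0 w hw⟩⟩
  have h1 : Tendsto Ψ (𝓝[c.1.U \ c.1.pre D] w) (𝓝 (Ψ w)) :=
    (hΨ.differentiableAt (hV.mem_nhds hw)).continuousAt.tendsto.mono_left nhdsWithin_le_nhds
  refine h1.congr' ?_
  filter_upwards [self_mem_nhdsWithin, nhdsWithin_le_nhds (hV.mem_nhds hw)] with y hy hyV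
    using (h y ⟨hyV, hy.2⟩).symm

theorem IsResidueData.mem_U (h : IsResidueData Ω α c z s Ψ) : z ∈ c.1.U := h.loc.mem.1

theorem IsResidueData.neBot (h : IsResidueData Ω α c z s Ψ) :
    (𝓝[c.1.U \ c.1.pre D] z).NeBot := h.loc.neBot (c.1.isOpen_U.mem_nhds h.mem_U)

theorem IsResidueData.unique (h : IsResidueData Ω α c z s Ψ) (h' : IsResidueData Ω α c z s Ψ') :
    Ψ = Ψ' :=
  have := h.neBot
  tendsto_nhds_unique h.tendsto h'.tendsto

theorem IsResidueData.clearedForm_eq (h : IsResidueData Ω α c z s Ψ) :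
    Ω.clearedForm α c s z = Ψ :=
  have := h.neBot
  h.tendsto.limUnder_eq

/-- Off `D̃`, `t^α Ω = (t/s)^α s^α Ω`, and `t/s` tends to the ratio `k` of the differentials. Only
the limit at `z` is needed, so first-order comparison replaces divisibility. -/
theorem IsResidueData.change (h : IsResidueData Ω α c z s Ψ)
    (ht : IsLocalDefining (c.1.pre D) t z) :
    ∃ k : ℂ, k ≠ 0 ∧ fderiv ℂ t z = k • fderiv ℂ s z ∧ IsResidueData Ω α c z t (k ^ α • Ψ) := by
  obtain ⟨k, hk, hd, hlim⟩ := h.loc.exists_ratio ht c.1.U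
  refine ⟨k, hk, hd, ht, ?_, smul_ne_zero (pow_ne_zero _ hk) h.ne_zero⟩
  refine ((hlim.pow α).smul h.tendsto).congr' ?_
  filter_upwards [self_mem_nhdsWithin, nhdsWithin_le_nhds h.loc.zero_iff] with w hw hsw
  have : s w ≠ 0 := fun h => hw.2 (hsw.1 h)
  rw [smul_smul, ← mul_pow, div_mul_cancel₀ _ this]

/-- The form `(ds v) ^ (-α) • (Ψ ⌟ v)`. -/
noncomputable def residueForm (α : ℕ) (s : CSpace (m + 1) → ℂ)
    (Ψ : (CSpace (m + 1)) [⋀^Fin (m + 1)]→L[ℂ] ℂ) (z v : CSpace (m + 1)) :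
    (CSpace (m + 1)) [⋀^Fin m]→L[ℂ] ℂ :=
  ((fderiv ℂ s z v) ^ α)⁻¹ • Ψ.curryLeft v

theorem residueForm_apply (v : CSpace (m + 1)) (u : Fin m → CSpace (m + 1)) :
    residueForm α s Ψ z v u = ((fderiv ℂ s z v) ^ α)⁻¹ * Ψ (Matrix.vecCons v u) := rfl

/-- The factor `k^α` gained by the cleared form cancels against that of `(dt v)^α`; a tangent change
of `v` contributes a top form on vectors of one hyperplane. -/
theorem IsResidueData.residueForm_apply_eq (h : IsResidueData Ω α c z s Ψ)
    (h' : IsResidueData Ω α c z t Ψ') {v v' : CSpace (m + 1)}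
    (hv : v - v' ∈ tangentTo (c.1.pre D) z) {u : Fin m → CSpace (m + 1)}
    (hu : ∀ i, u i ∈ tangentTo (c.1.pre D) z) :
    residueForm α s Ψ z v u = residueForm α t Ψ' z v' u := by
  obtain ⟨k, hk, hd, hdata⟩ := h.change h'.loc
  obtain rfl := h'.unique hdata
  have hv0 := h.loc.mem_tangentTo.1 hv
  have hvv : fderiv ℂ s z v = fderiv ℂ s z v' := by
    rw [map_sub] at hv0; exact sub_eq_zero.1 hv0
  have hΨ : Ψ (Matrix.vecCons v u) = Ψ (Matrix.vecCons v' u) := by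
    have h1 : Ψ (Matrix.vecCons (v - v') u) = 0 := by
      refine alternating_vecCons_eq_zero h.loc.deriv_ne fun i => ?_
      refine Fin.cases hv0 (fun i => ?_) i
      exact h.loc.mem_tangentTo.1 (hu i)
    simp only [← ContinuousAlternatingMap.curryLeft_apply_apply, map_sub,
      ContinuousAlternatingMap.sub_apply] at h1 ⊢
    exact sub_eq_zero.1 h1
  have hdv : fderiv ℂ t z v' = k * fderiv ℂ s z v' := by simp [hd]
  rw [residueForm_apply, residueForm_apply, hvv, hΨ, hdv, mul_pow, mul_inv,
    ContinuousAlternatingMap.smul_apply, smul_eq_mul]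
  field_simp

theorem IsResidueData.restrictForm_ne_zero (h : IsResidueData Ω α c z s Ψ) {v : CSpace (m + 1)}
    (hv : v ∉ tangentTo (c.1.pre D) z) :
    restrictForm c.1 D z (residueForm α s Ψ z v) ≠ 0 := by
  rw [h.loc.mem_tangentTo] at hv
  obtain ⟨u, hu, hli⟩ := exists_linearIndependent_ker h.loc.deriv_ne
  intro h0
  have h1 := DFunLike.congr_fun h0
    (fun i => (⟨u i, h.loc.mem_tangentTo.2 (hu i)⟩ : tangentTo (c.1.pre D) z))
  have h2 : residueForm α s Ψ z v u = 0 := h1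
  rw [residueForm_apply] at h2
  exact (mul_ne_zero (inv_ne_zero (pow_ne_zero _ hv))
    (alternating_vecCons_ne_zero h.ne_zero hv hu hli)) h2

theorem NormalPt.notMem_of_vec_eq {p : NormalPt c.1 D} {v : CSpace (m + 1)}
    (h : p.vec = Submodule.Quotient.mk v) : v ∉ tangentTo (c.1.pre D) p.pt := fun hv =>
  p.ne_zero (h.trans ((Submodule.Quotient.mk_eq_zero _).2 hv))

/-- One form works for all local data at once, so the choice made in `residueLift` is harmless and
any convenient `s`, `Ψ`, `v` may be used to compute it. -/
theorem HolVolForm.BlowsUpToOrder.exists_form (hΩ : Ω.BlowsUpToOrder α) (p : NormalPt c.1 D) :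
    ∃ η : tangentTo (c.1.pre D) p.pt [⋀^Fin m]→L[ℂ] ℂ, η ≠ 0 ∧ ∀ s Ψ v,
      IsResidueData Ω α c p.pt s Ψ → p.vec = Submodule.Quotient.mk v →
        η = restrictForm c.1 D p.pt (residueForm α s Ψ p.pt v) := by
  obtain ⟨V, -, -, hzV, s, -, Ψ, -, hdata⟩ := hΩ.exists_residueData p.mem
  have h := hdata p.pt hzV p.mem
  obtain ⟨v, hv⟩ := Submodule.Quotient.mk_surjective _ p.vec
  refine ⟨_, h.restrictForm_ne_zero (NormalPt.notMem_of_vec_eq hv.symm),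
    fun t Ψ' v' h' hv' => ?_⟩
  ext u
  exact h.residueForm_apply_eq h' ((Submodule.Quotient.eq _).1 (hv.trans hv')) fun i => (u i).2

/-- The lift of the residue map of `Ω` to a chart. -/
noncomputable def residueLift (hΩ : Ω.BlowsUpToOrder α) (c : O.atlas) (p : NormalPt c.1 D) :
    CanonPt c.1 D where
  pt := p.pt
  mem := p.mem
  form := (hΩ.exists_form p).choose
  ne_zero := (hΩ.exists_form p).choose_spec.1

theorem residueLift_form (hΩ : Ω.BlowsUpToOrder α) {p : NormalPt c.1 D} {v : CSpace (m + 1)}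
    (h : IsResidueData Ω α c p.pt s Ψ) (hv : p.vec = Submodule.Quotient.mk v) :
    (residueLift hΩ c p).form = restrictForm c.1 D p.pt (residueForm α s Ψ p.pt v) :=
  (hΩ.exists_form p).choose_spec.2 s Ψ v h hv

/-- By invariance of `Ω`, pulling back `s^α Ω` gives `(s ∘ f)^α Ω`; the limit passes through because
`df` is continuous. -/
theorem IsResidueData.pullback {f : CSpace (m + 1) → CSpace (m + 1)} (hf : IsInjection c.1 d.1 f)
    (hz : z ∈ c.1.U) (h : IsResidueData Ω α d (f z) s Ψ) :
    IsResidueData Ω α c z (s ∘ f) (Ψ.compContinuousLinearMap (fderiv ℂ f z)) where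
  loc := h.loc.comp (hf.eventually_differentiableAt hz) (hf.immersion z hz) (by
    filter_upwards [c.1.isOpen_U.mem_nhds hz] with w hw using hf.mem_pre_iff hw)
  tendsto := by
    have h1 := h.tendsto.comp (hf.tendsto_diff (D := D) hz)
    have h2 : Tendsto (fun w => ContinuousAlternatingMap.compContinuousLinearMapCLM (F := ℂ)
        (ι := Fin (m + 1)) (fderiv ℂ f w)) (𝓝[c.1.U \ c.1.pre D] z)
        (𝓝 (ContinuousAlternatingMap.compContinuousLinearMapCLM (fderiv ℂ f z))) :=
      (ContinuousAlternatingMap.continuous_compContinuousLinearMapCLM.tendsto _).comp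
        ((differentiableAt_fderiv_of_eventually
          (hf.eventually_differentiableAt hz)).continuousAt.tendsto.mono_left nhdsWithin_le_nhds)
    refine ((isBoundedBilinearMap_apply.continuous.tendsto (_, _)).comp
      (h2.prodMk_nhds h1)).congr' ?_
    filter_upwards [self_mem_nhdsWithin] with w hw
    rw [← Ω.invariant c d f hf w hw]
    rfl
  ne_zero := by
    intro h0
    refine h.ne_zero (ContinuousAlternatingMap.ext fun v => ?_)
    choose w hw using hf.surjective_fderiv hz
    have := DFunLike.congr_fun h0 (fun i => w (v i))
    simpa [Function.comp_def, hw] using this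

/-- Computing the target with `s` and the source with `s ∘ f`, the chain rule makes both sides the
same number. -/
theorem residueLift_compat (hΩ : Ω.BlowsUpToOrder α) {f : CSpace (m + 1) → CSpace (m + 1)}
    (hf : IsInjection c.1 d.1 f) {p : NormalPt c.1 D} {q : NormalPt d.1 D} (h : NormalRel f p q) :
    CanonRel f (residueLift hΩ c p) (residueLift hΩ d q) := by
  obtain ⟨qpt, qmem, qvec, qne⟩ := q
  obtain ⟨hq, v, hpv, hqv⟩ := h
  dsimp only at hq hqv
  subst hq
  refine ⟨rfl, fun u u' huu' => ?_⟩
  obtain ⟨V, -, -, hzV, s, -, Ψ, -, hdata⟩ := hΩ.exists_residueData qmem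
  have hd := hdata _ hzV qmem
  have hc := hd.pullback hf p.mem.1
  rw [residueLift_form hΩ (p := ⟨f p.pt, qmem, qvec, qne⟩) hd hqv, residueLift_form hΩ hc hpv]
  change residueForm α s (Ψ (f p.pt)) (f p.pt) (fderiv ℂ f p.pt v) (fun i => (u' i : CSpace (m + 1))) =
    residueForm α (s ∘ f) _ p.pt v (fun i => (u i : CSpace (m + 1)))
  rw [residueForm_apply, residueForm_apply,
    fderiv_comp p.pt hd.loc.holo.self_of_nhds (hf.differentiableAt p.mem.1)]
  refine congrArg₂ _ rfl (congrArg (Ψ (f p.pt)) (funext fun i => ?_))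
  refine Fin.cases rfl (fun i => ?_) i
  exact huu' i

/-- The residue map of a volume form that blows up to order `α`. -/
noncomputable def residueMap (hΩ : Ω.BlowsUpToOrder α) : NormalToCanonMap O D where
  toFun := Quot.map (fun p => ⟨p.1, residueLift hΩ p.1 p.2⟩)
    fun _ _ ⟨f, hf, h⟩ => ⟨f, hf, residueLift_compat hΩ hf h⟩
  lift := residueLift hΩ
  toFun_mk _ _ := rfl
  compat _ _ _ hf _ _ h := residueLift_compat hΩ hf h

end Residue

/-! ### Pullbacks of coverings, and the power map -/

section Covering

/-- A map that is the pullback of a covering map is a covering map. -/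
theorem IsCoveringMap.of_pullback {E Y A B : Type*} [TopologicalSpace E] [TopologicalSpace Y]
    [TopologicalSpace A] [TopologicalSpace B] {P : A → B} (hP : IsCoveringMap P) {f : E → Y}
    (hf : Continuous f) {l : E → A} (hl : Continuous l) {h : Y → B} (hh : Continuous h)
    (hcomm : ∀ e, h (f e) = P (l e)) {r : Y × A → E} (hr : Continuous r)
    (hfr : ∀ y a, P a = h y → f (r (y, a)) = y) (hlr : ∀ y a, l (r (y, a)) = a)
    (hrf : ∀ e, r (f e, l e) = e) : IsCoveringMap f := by
  intro y
  obtain ⟨hI, U, hyU, hU, hPU, H, hH⟩ := hP (h y)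
  have hPH : ∀ b i, P (H.symm (b, i)) = b := fun b i => by rw [← hH]; simp
  -- Here `r` inverts `(f, l)` on the fibre product of `h` and `P`. Over `h ⁻¹' U` the
  -- trivialisation sends `e` to `f e` and the sheet of `l e`.
  refine IsEvenlyCovered.to_isEvenlyCovered_preimage (I := P ⁻¹' {h y})
    ⟨hI, h ⁻¹' U, hyU, hU.preimage hh, (hU.preimage hh).preimage hf, ?_⟩
  refine ⟨{
    toFun e := (⟨f e, e.2⟩, (H ⟨l e, by
      have he : h (f e) ∈ U := e.2
      rwa [hcomm] at he⟩).2)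
    invFun x := ⟨r (x.1, H.symm (⟨h x.1, x.1.2⟩, x.2)), by
      have := x.1.2
      simp only [Set.mem_preimage] at this ⊢
      rwa [hfr _ _ (by rw [hPH])]⟩
    left_inv e := ?_
    right_inv x := ?_
    continuous_toFun := by fun_prop
    continuous_invFun := by fun_prop }, fun _ => rfl⟩
  · have he : l e ∈ P ⁻¹' U := by
      have := e.2
      simpa only [Set.mem_preimage, hcomm] using this
    have h1 : ((⟨h (f e), e.2⟩ : U), (H ⟨l e, he⟩).2) = H ⟨l e, he⟩ :=
      Prod.ext (Subtype.ext ((hcomm e).trans (hH ⟨l e, he⟩).symm)) rfl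
    refine Subtype.ext ?_
    simp only [h1, Homeomorph.symm_apply_apply, hrf]
  · obtain ⟨⟨x, hx⟩, i⟩ := x
    refine Prod.ext (Subtype.ext (hfr _ _ (by rw [hPH]))) ?_
    simp [hlr]

theorem Nat.card_fiber_of_pullback {E Y A B : Type*} {P : A → B} {f : E → Y} {l : E → A}
    {h : Y → B} (hcomm : ∀ e, h (f e) = P (l e)) {r : Y × A → E}
    (hfr : ∀ y a, P a = h y → f (r (y, a)) = y) (hlr : ∀ y a, l (r (y, a)) = a)
    (hrf : ∀ e, r (f e, l e) = e) (y : Y) : Nat.card (f ⁻¹' {y}) = Nat.card (P ⁻¹' {h y}) :=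
  Nat.card_congr
    { toFun e := ⟨l e, by
        have := e.2
        simp only [Set.mem_preimage, Set.mem_singleton_iff] at this ⊢
        rw [← hcomm, this]⟩
      invFun a := ⟨r (y, a), hfr y a a.2⟩
      left_inv e := Subtype.ext (by
        have h1 : f e = y := e.2
        have h2 := hrf (e : E)
        rwa [h1] at h2)
      right_inv a := Subtype.ext (hlr y a) }

theorem Nat.card_fiber_restrictPreimage {E Y : Type*} (f : E → Y) (B : Set Y) (y : B) :
    Nat.card (B.restrictPreimage f ⁻¹' {y}) = Nat.card (f ⁻¹' {(y : Y)}) :=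
  Nat.card_congr
    { toFun e := ⟨e.1.1, congrArg Subtype.val e.2⟩
      invFun e := ⟨⟨e.1, by
        have h1 : f e = y := e.2
        rw [Set.mem_preimage, h1]
        exact y.2⟩, Subtype.ext e.2⟩
      left_inv _ := rfl
      right_inv _ := rfl }

/-- The fibre over `μ` consists of the `k`-th roots of `μ⁻¹`. -/
theorem Complex.card_fiber_zpow {k : ℕ} (hk : 0 < k) (μ : {x : ℂ // x ≠ 0}) :
    Nat.card ((fun x : {x : ℂ // x ≠ 0} =>
      (⟨x ^ (-(k : ℤ)), zpow_ne_zero _ x.2⟩ : {x : ℂ // x ≠ 0})) ⁻¹' {μ}) = k := by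
  classical
  have hprim := Complex.isPrimitiveRoot_exp k hk.ne'
  have hμ : (μ : ℂ)⁻¹ ≠ 0 := inv_ne_zero μ.2
  have hcard : (Polynomial.nthRoots k (μ : ℂ)⁻¹).toFinset.card = k := by
    rw [Multiset.toFinset_card_of_nodup (hprim.nthRoots_nodup hμ), hprim.card_nthRoots, if_pos]
    exact IsAlgClosed.exists_pow_nat_eq _ hk
  have hmem : ∀ x : {x : ℂ // x ≠ 0}, (⟨x ^ (-(k : ℤ)), zpow_ne_zero _ x.2⟩ : {x : ℂ // x ≠ 0}) = μ
      ↔ (x : ℂ) ∈ (Polynomial.nthRoots k (μ : ℂ)⁻¹).toFinset := fun x => by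
    rw [Multiset.mem_toFinset, Polynomial.mem_nthRoots hk, Subtype.ext_iff]
    change (x : ℂ) ^ (-(k : ℤ)) = μ ↔ _
    rw [zpow_neg, zpow_natCast, inv_eq_iff_eq_inv]
  rw [← Fintype.card_coe, ← Nat.card_eq_fintype_card] at hcard
  refine Eq.trans (Nat.card_congr ?_) hcard
  exact
    { toFun x := ⟨x.1, (hmem x.1).1 x.2⟩
      invFun x := ⟨⟨x.1, by
        have := x.2
        rw [Multiset.mem_toFinset, Polynomial.mem_nthRoots hk] at this
        rintro h0
        rw [h0, zero_pow hk.ne'] at this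
        exact hμ this.symm⟩, (hmem _).2 x.2⟩
      left_inv _ := rfl
      right_inv _ := rfl }

/-- The total spaces carry quotient topologies; over an open set, continuity may still be tested
upstairs. -/
theorem continuousOn_of_coinduced {A Y Z : Type*} [TopologicalSpace A] [tY : TopologicalSpace Y]
    [TopologicalSpace Z] {q : A → Y} (hq : tY = TopologicalSpace.coinduced q inferInstance)
    {B : Set Y} (hB : IsOpen B) {g : Y → Z} (hg : ContinuousOn (g ∘ q) (q ⁻¹' B)) :
    ContinuousOn g B := by
  have hqc : Continuous q := continuous_iff_coinduced_le.2 hq.ge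
  rw [continuousOn_open_iff hB]
  intro t ht
  have h := (continuousOn_open_iff (hB.preimage hqc)).1 hg t ht
  subst hq
  rwa [isOpen_coinduced]

end Covering

theorem DifferentiableOn.curryLeft {E G : Type*} [NormedAddCommGroup E] [NormedSpace ℂ E]
    [NormedAddCommGroup G] [NormedSpace ℂ G] {n : ℕ} {S : Set G}
    {Ψ : G → E [⋀^Fin (n + 1)]→L[ℂ] ℂ} (h : DifferentiableOn ℂ Ψ S) :
    DifferentiableOn ℂ (fun p => (Ψ p).curryLeft) S := by
  have hL := (ContinuousAlternatingMap.curryLeftLI (𝕜 := ℂ) (E := E) (F := ℂ)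
    (n := n)).toContinuousLinearMap.differentiable
  refine Differentiable.comp_differentiableOn (g := fun η => η.curryLeft) ?_ h
  exact hL

/-! ### Holomorphy and continuity of the residue map -/

section Lift

open Filter

variable {X : Type u} [TopologicalSpace X] {m : ℕ} {O : ComplexOrbifold X (m + 1)} {D : Set X}
  {Ω : HolVolForm O D} {α : ℕ} {c d : O.atlas} {z : CSpace (m + 1)} {s t : CSpace (m + 1) → ℂ}
  {Ψ Ψ' : (CSpace (m + 1)) [⋀^Fin (m + 1)]→L[ℂ] ℂ}

/-- The forms have different types until the base points are identified, so they are compared on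
families with equal underlying vectors. -/
theorem CanonPt.ext_of_apply {c : OrbChart X (m + 1)} {y y' : CanonPt c D} (h : y.pt = y'.pt)
    (hf : ∀ (u : Fin m → tangentTo (c.pre D) y.pt) (u' : Fin m → tangentTo (c.pre D) y'.pt),
      (∀ i, (u i : CSpace (m + 1)) = u' i) → y.form u = y'.form u') : y = y' := by
  obtain ⟨pt, mem, η, hη⟩ := y
  obtain ⟨pt', mem', η', hη'⟩ := y'
  dsimp only at h hf
  subst h
  have : η = η' := ContinuousAlternatingMap.ext fun u => hf u u fun _ => rfl
  subst this
  rfl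

theorem NormalPt.continuous_ofVec (c : OrbChart X (m + 1)) (D : Set X) :
    Continuous (NormalPt.ofVec (c := c) (D := D)) := continuous_coinduced_rng

theorem CanonPt.continuous_ofForm (c : OrbChart X (m + 1)) (D : Set X) :
    Continuous (CanonPt.ofForm (c := c) (D := D)) := continuous_coinduced_rng

theorem NormalPt.continuous_pt (c : OrbChart X (m + 1)) (D : Set X) :
    Continuous (NormalPt.pt (c := c) (D := D)) :=
  continuous_coinduced_dom.2 (continuous_fst.comp continuous_subtype_val)

theorem CanonPt.continuous_pt (c : OrbChart X (m + 1)) (D : Set X) :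
    Continuous (CanonPt.pt (c := c) (D := D)) :=
  continuous_coinduced_dom.2 (continuous_fst.comp continuous_subtype_val)

theorem residueMap_isHolomorphic (hΩ : Ω.BlowsUpToOrder α) : (residueMap hΩ).IsHolomorphic := by
  intro c z v hz hv
  obtain ⟨V, -, hV, hzV, s, hs, Ψ, hΨ, hdata⟩ := hΩ.exists_residueData hz
  have hds : DifferentiableOn ℂ (fun p : CSpace (m + 1) × CSpace (m + 1) => fderiv ℂ s p.1 p.2)
      (V ×ˢ Set.univ) :=
    ((differentiableOn_fderiv_of_isOpen hV hs).comp differentiableOn_fst fun p hp => hp.1).clm_apply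
      differentiableOn_snd
  have hopen : IsOpen (V ×ˢ (Set.univ : Set (CSpace (m + 1)))) := hV.prod isOpen_univ
  -- The open set is where `w ∈ V` and `ds_w(v) ≠ 0`; there the residue formula makes sense off `D̃`
  -- too.
  refine ⟨_, hds.continuousOn.isOpen_inter_preimage hopen (isOpen_compl_singleton (x := (0 : ℂ))),
    ⟨⟨hzV, trivial⟩, fun h => hv ((hdata z hzV hz).loc.mem_tangentTo.2 h)⟩,
    fun p => (p.1, residueForm α s (Ψ p.1) p.1 p.2), ?_, ?_⟩
  · refine differentiableOn_fst.prodMk ?_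
    refine DifferentiableOn.smul (((hds.mono Set.inter_subset_left).pow α).inv fun p hp =>
      pow_ne_zero _ hp.2) ?_
    have h0 : DifferentiableOn ℂ (fun p : CSpace (m + 1) × CSpace (m + 1) => Ψ p.1)
        (V ×ˢ Set.univ) := hΨ.comp differentiableOn_fst fun p hp => hp.1
    have h1 : DifferentiableOn ℂ (fun p : CSpace (m + 1) × CSpace (m + 1) => (Ψ p.1).curryLeft)
        (V ×ˢ Set.univ) := h0.curryLeft
    exact (h1.mono Set.inter_subset_left).clm_apply differentiableOn_snd
  · intro p hp
    have hd := hdata p.1.1 hp.1.1 p.2.1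
    refine ⟨⟨p.2.1, hd.restrictForm_ne_zero p.2.2⟩, CanonPt.ext_of_apply rfl fun u u' huu' => ?_⟩
    obtain rfl : u = u' := funext fun i => Subtype.ext (huu' i)
    exact DFunLike.congr_fun (residueLift_form hΩ (p := NormalPt.ofVec p) hd rfl) u

theorem NormalToCanonMap.IsHolomorphic.continuous_lift {φ : NormalToCanonMap O D}
    (h : φ.IsHolomorphic) (c : O.atlas) : Continuous (φ.lift c) := by
  refine continuous_coinduced_dom.2 (continuous_iff_continuousAt.2 fun p => ?_)
  obtain ⟨W, hW, hpW, F, hF, hFl⟩ := h c p.1.1 p.1.2 p.2.1 p.2.2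
  have hW' := hW.preimage (continuous_subtype_val (p := fun p : CSpace (m + 1) × CSpace (m + 1) =>
    p.1 ∈ c.1.pre D ∧ p.2 ∉ tangentTo (c.1.pre D) p.1))
  refine ContinuousOn.continuousAt ?_ (hW'.mem_nhds hpW)
  rw [continuousOn_iff_continuous_domRestrict]
  have heq : Set.domRestrict (Subtype.val ⁻¹' W) (φ.lift c ∘ NormalPt.ofVec) =
      fun q => CanonPt.ofForm ⟨F q.1.1, (hFl q.1 q.2).choose⟩ :=
    funext fun q => (hFl q.1 q.2).choose_spec
  rw [heq]
  refine (CanonPt.continuous_ofForm c.1 D).comp (Continuous.subtype_mk ?_ _)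
  exact hF.continuousOn.comp_continuous
    (continuous_subtype_val.comp continuous_subtype_val) fun q => q.2

theorem NormalToCanonMap.IsHolomorphic.continuous_toFun {φ : NormalToCanonMap O D}
    (h : φ.IsHolomorphic) : Continuous φ.toFun := by
  refine continuous_coinduced_dom.2 (continuous_sigma fun c => ?_)
  have : (φ.toFun ∘ Quot.mk _) ∘ Sigma.mk c = CanonTotal.mk O D c ∘ φ.lift c :=
    funext fun p => φ.toFun_mk c p
  change Continuous ((φ.toFun ∘ Quot.mk _) ∘ Sigma.mk c)
  rw [this]
  exact (continuous_quot_mk.comp continuous_sigmaMk).comp (h.continuous_lift c)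

theorem NormalToCanonMap.surjective_toFun {φ : NormalToCanonMap O D}
    (h : ∀ c, Function.Surjective (φ.lift c)) : Function.Surjective φ.toFun := by
  rintro ⟨c, y⟩
  obtain ⟨p, rfl⟩ := h c y
  exact ⟨NormalTotal.mk O D c p, φ.toFun_mk c p⟩

end Lift

/-! ### Fibre coordinates and the covering property -/

section Frame

open Filter

variable {X : Type u} [TopologicalSpace X] {m : ℕ} {O : ComplexOrbifold X (m + 1)} {D : Set X}
  {Ω : HolVolForm O D} {α : ℕ} {c d : O.atlas} {z : CSpace (m + 1)} {s t : CSpace (m + 1) → ℂ}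

/-- Local data near a point of `D̃`: a defining function `s`, the extension `Ψ` of `s ^ α • Ω`, and
a continuous frame `ν, τ` of `TŨ` with `ds(ν) = 1` and `ds(τ) = 0`. -/
structure IsLocalFrame (Ω : HolVolForm O D) (α : ℕ) (c : O.atlas) (V : Set (CSpace (m + 1)))
    (s : CSpace (m + 1) → ℂ)
    (Ψ : CSpace (m + 1) → (CSpace (m + 1)) [⋀^Fin (m + 1)]→L[ℂ] ℂ)
    (ν : CSpace (m + 1) → CSpace (m + 1)) (τ : CSpace (m + 1) → Fin m → CSpace (m + 1)) :
    Prop where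
  isOpen : IsOpen V
  data : ∀ w ∈ V, w ∈ c.1.pre D → IsResidueData Ω α c w s (Ψ w)
  cont_ds : ContinuousOn (fderiv ℂ s) V
  cont_Ψ : ContinuousOn Ψ V
  cont_ν : ContinuousOn ν V
  cont_τ : ContinuousOn τ V
  ds_ν : ∀ w ∈ V, fderiv ℂ s w (ν w) = 1
  ds_τ : ∀ w ∈ V, ∀ i, fderiv ℂ s w (τ w i) = 0
  ne_zero : ∀ w ∈ V, Ψ w (Matrix.vecCons (ν w) (τ w)) ≠ 0

theorem continuousOn_vecCons {A : Type*} [TopologicalSpace A] {V : Set A}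
    {a : A → CSpace (m + 1)} {b : A → Fin m → CSpace (m + 1)} (ha : ContinuousOn a V)
    (hb : ContinuousOn b V) :
    ContinuousOn (fun w => (Matrix.vecCons (a w) (b w) : Fin (m + 1) → CSpace (m + 1))) V := by
  refine continuousOn_pi.2 fun i => ?_
  refine Fin.cases ha (fun i => ?_) i
  exact continuousOn_pi.1 hb i

theorem HolVolForm.BlowsUpToOrder.exists_isLocalFrame (hΩ : Ω.BlowsUpToOrder α)
    (hz : z ∈ c.1.pre D) : ∃ V s Ψ ν τ, z ∈ V ∧ IsLocalFrame Ω α c V s Ψ ν τ := by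
  obtain ⟨V, -, hV, hzV, s, hs, Ψ, hΨ, hdata⟩ := hΩ.exists_residueData hz
  have hd := hdata z hzV hz
  obtain ⟨v, hv⟩ := exists_apply_eq_one hd.loc.deriv_ne
  obtain ⟨u, hu, hli⟩ := exists_linearIndependent_ker hd.loc.deriv_ne
  have hds : ContinuousOn (fderiv ℂ s) V := (differentiableOn_fderiv_of_isOpen hV hs).continuousOn
  set V₁ : Set (CSpace (m + 1)) := V ∩ (fun w => fderiv ℂ s w v) ⁻¹' {0}ᶜ with hV₁
  have hV₁o : IsOpen V₁ :=
    (hds.clm_apply continuousOn_const).isOpen_inter_preimage hV isOpen_compl_singleton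
  -- The constant vectors adapted to `z` are corrected at `w`: `v` is normalised to `ds_w(ν) = 1`,
  -- and the `u i` are projected along `ν` into the kernel of `ds_w`.
  let ν : CSpace (m + 1) → CSpace (m + 1) := fun w => (fderiv ℂ s w v)⁻¹ • v
  let τ : CSpace (m + 1) → Fin m → CSpace (m + 1) := fun w i => u i - fderiv ℂ s w (u i) • ν w
  have hν : ContinuousOn ν V₁ :=
    (((hds.clm_apply continuousOn_const).mono Set.inter_subset_left).inv₀ fun w hw =>
      hw.2).smul continuousOn_const
  have hτ : ContinuousOn τ V₁ := continuousOn_pi.2 fun i => continuousOn_const.sub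
    (((hds.mono Set.inter_subset_left).clm_apply continuousOn_const).smul hν)
  have hev : ContinuousOn (fun w => Ψ w (Matrix.vecCons (ν w) (τ w))) V₁ :=
    (hΨ.continuousOn.mono Set.inter_subset_left).eval (continuousOn_vecCons hν hτ)
  have hν1 : ∀ w ∈ V₁, fderiv ℂ s w (ν w) = 1 := fun w hw => by
    simp only [ν, map_smul, smul_eq_mul]
    exact inv_mul_cancel₀ hw.2
  refine ⟨V₁ ∩ (fun w => Ψ w (Matrix.vecCons (ν w) (τ w))) ⁻¹' {0}ᶜ, s, Ψ, ν, τ,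
    ⟨⟨hzV, by simp [hv]⟩, ?_⟩, hev.isOpen_inter_preimage hV₁o isOpen_compl_singleton,
    fun w hw => hdata w hw.1.1, hds.mono fun w hw => hw.1.1, hΨ.continuousOn.mono fun w hw => hw.1.1,
    hν.mono Set.inter_subset_left, hτ.mono Set.inter_subset_left, fun w hw => hν1 w hw.1,
    fun w hw i => ?_, fun w hw => hw.2⟩
  · have h1 : ν z = v := by simp [ν, hv]
    have h2 : τ z = u := funext fun i => by simp [τ, hu i]
    simp only [Set.mem_preimage, h1, h2]
    exact alternating_vecCons_ne_zero (ℓ := fderiv ℂ s z) hd.ne_zero (by simp [hv]) hu hli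
  · simp [τ, hν1 w hw.1]

namespace IsLocalFrame

variable {V : Set (CSpace (m + 1))}
    {Ψ : CSpace (m + 1) → (CSpace (m + 1)) [⋀^Fin (m + 1)]→L[ℂ] ℂ}
    {ν : CSpace (m + 1) → CSpace (m + 1)} {τ : CSpace (m + 1) → Fin m → CSpace (m + 1)}

theorem mem_tangentTo (h : IsLocalFrame Ω α c V s Ψ ν τ) {w : CSpace (m + 1)} (hw : w ∈ V)
    (hwD : w ∈ c.1.pre D) (i : Fin m) : τ w i ∈ tangentTo (c.1.pre D) w :=
  (h.data w hw hwD).loc.mem_tangentTo.2 (h.ds_τ w hw i)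

theorem linearIndependent (h : IsLocalFrame Ω α c V s Ψ ν τ) {w : CSpace (m + 1)} (hw : w ∈ V) :
    LinearIndependent ℂ (τ w) := by
  have h1 : LinearIndependent ℂ
      (Matrix.vecCons (ν w) (τ w) : Fin (m + 1) → CSpace (m + 1)) := by
    by_contra hli
    exact h.ne_zero w hw ((Ψ w).toAlternatingMap.map_linearDependent _ hli)
  exact (linearIndependent_finCons.1 h1).1

/-- The fibre coordinate `λ` of the point `(z, λ ∂/∂s)`. -/
noncomputable def normalCoord (c : OrbChart X (m + 1)) (D : Set X) (s : CSpace (m + 1) → ℂ)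
    (p : NormalPt c D) : ℂ := fderiv ℂ s p.pt (Quotient.out p.vec)

open Classical in
/-- The fibre coordinate of a point of `K_D̃` with respect to a frame. -/
noncomputable def canonCoord (c : OrbChart X (m + 1)) (D : Set X)
    (Ψ : CSpace (m + 1) → (CSpace (m + 1)) [⋀^Fin (m + 1)]→L[ℂ] ℂ)
    (ν : CSpace (m + 1) → CSpace (m + 1)) (τ : CSpace (m + 1) → Fin m → CSpace (m + 1))
    (y : CanonPt c D) : ℂ :=
  (if h : ∀ i, τ y.pt i ∈ tangentTo (c.pre D) y.pt then y.form fun i => ⟨τ y.pt i, h i⟩ else 0) /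
    Ψ y.pt (Matrix.vecCons (ν y.pt) (τ y.pt))

/-- The differential `ds` kills tangent vectors, so the representative picked by `Quotient.out` is
immaterial. -/
theorem normalCoord_eq (h : IsLocalFrame Ω α c V s Ψ ν τ) {p : NormalPt c.1 D} (hp : p.pt ∈ V)
    {v : CSpace (m + 1)} (hv : p.vec = Submodule.Quotient.mk v) :
    normalCoord c.1 D s p = fderiv ℂ s p.pt v := by
  have h1 : (Submodule.Quotient.mk (Quotient.out p.vec) :
      CSpace (m + 1) ⧸ tangentTo (c.1.pre D) p.pt) = Submodule.Quotient.mk v :=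
    (Quotient.out_eq p.vec).trans hv
  have h2 := (h.data p.pt hp p.mem).loc.mem_tangentTo.1 ((Submodule.Quotient.eq _).1 h1)
  rw [map_sub] at h2
  exact sub_eq_zero.1 h2

theorem vec_eq (h : IsLocalFrame Ω α c V s Ψ ν τ) {p : NormalPt c.1 D} (hp : p.pt ∈ V) :
    p.vec = Submodule.Quotient.mk (normalCoord c.1 D s p • ν p.pt) := by
  obtain ⟨v, hv⟩ := Submodule.Quotient.mk_surjective _ p.vec
  rw [h.normalCoord_eq hp hv.symm, ← hv, Submodule.Quotient.eq,
    (h.data p.pt hp p.mem).loc.mem_tangentTo]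
  simp [h.ds_ν p.pt hp]

theorem normalCoord_ne_zero (h : IsLocalFrame Ω α c V s Ψ ν τ) {p : NormalPt c.1 D}
    (hp : p.pt ∈ V) : normalCoord c.1 D s p ≠ 0 := fun h0 => by
  have := h.vec_eq hp
  rw [h0, zero_smul] at this
  exact p.ne_zero this

theorem smul_ν_notMem (h : IsLocalFrame Ω α c V s Ψ ν τ) {w : CSpace (m + 1)} (hw : w ∈ V)
    (hwD : w ∈ c.1.pre D) {a : ℂ} (ha : a ≠ 0) : a • ν w ∉ tangentTo (c.1.pre D) w := by
  rw [(h.data w hw hwD).loc.mem_tangentTo]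
  simpa [h.ds_ν w hw] using ha

/-- Over `V` the frame vectors are tangent and the default value `0` never occurs. The division by
`Ψ(ν, τ)` normalises the residue map to a pure power. -/
theorem canonCoord_eq (h : IsLocalFrame Ω α c V s Ψ ν τ) {y : CanonPt c.1 D} (hy : y.pt ∈ V) :
    canonCoord c.1 D Ψ ν τ y = y.form (fun i => ⟨τ y.pt i, h.mem_tangentTo hy y.mem i⟩) /
      Ψ y.pt (Matrix.vecCons (ν y.pt) (τ y.pt)) := by
  rw [canonCoord, dif_pos fun i => h.mem_tangentTo hy y.mem i]

theorem finrank_tangentTo (h : IsLocalFrame Ω α c V s Ψ ν τ) {w : CSpace (m + 1)} (hw : w ∈ V)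
    (hwD : w ∈ c.1.pre D) : Module.finrank ℂ (tangentTo (c.1.pre D) w) = m := by
  rw [(h.data w hw hwD).loc.tangentTo_eq]
  exact finrank_ker_eq (h.data w hw hwD).loc.deriv_ne

theorem canonPt_ext (h : IsLocalFrame Ω α c V s Ψ ν τ) {y y' : CanonPt c.1 D} (hy : y.pt ∈ V)
    (hpt : y.pt = y'.pt) (hcoord : canonCoord c.1 D Ψ ν τ y = canonCoord c.1 D Ψ ν τ y') :
    y = y' := by
  rw [h.canonCoord_eq hy, h.canonCoord_eq (hpt ▸ hy)] at hcoord
  obtain ⟨pt, mem, η, hη⟩ := y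
  obtain ⟨pt', mem', η', hη'⟩ := y'
  dsimp only at hpt hcoord hy
  subst hpt
  have h1 := (div_left_inj' (h.ne_zero pt hy)).1 hcoord
  have hli : LinearIndependent ℂ fun i => (⟨τ pt i, h.mem_tangentTo hy mem i⟩ :
      tangentTo (c.1.pre D) pt) :=
    LinearIndependent.of_comp (tangentTo (c.1.pre D) pt).subtype (h.linearIndependent hy)
  obtain rfl := alternating_ext_of_linearIndependent (h.finrank_tangentTo hy mem) hli h1
  rfl

theorem canonCoord_ne_zero (h : IsLocalFrame Ω α c V s Ψ ν τ) {y : CanonPt c.1 D}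
    (hy : y.pt ∈ V) : canonCoord c.1 D Ψ ν τ y ≠ 0 := by
  rw [h.canonCoord_eq hy]
  refine div_ne_zero (fun h0 => y.ne_zero ?_) (h.ne_zero _ hy)
  have hli : LinearIndependent ℂ fun i => (⟨τ y.pt i, h.mem_tangentTo hy y.mem i⟩ :
      tangentTo (c.1.pre D) y.pt) :=
    LinearIndependent.of_comp (tangentTo (c.1.pre D) y.pt).subtype (h.linearIndependent hy)
  exact alternating_ext_of_linearIndependent (h.finrank_tangentTo hy y.mem) hli (by simpa using h0)

/-- Rescaling contributes `λ^(-α)` and the contraction contributes `λ`. -/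
theorem canonCoord_residueLift (hΩ : Ω.BlowsUpToOrder α) (h : IsLocalFrame Ω α c V s Ψ ν τ)
    (hα : 2 ≤ α) {p : NormalPt c.1 D} (hp : p.pt ∈ V) :
    canonCoord c.1 D Ψ ν τ (residueLift hΩ c p) =
      normalCoord c.1 D s p ^ (-((α - 1 : ℕ) : ℤ)) := by
  rw [h.canonCoord_eq (y := residueLift hΩ c p) hp,
    residueLift_form hΩ (h.data p.pt hp p.mem) (h.vec_eq hp)]
  change residueForm α s (Ψ p.pt) p.pt (normalCoord c.1 D s p • ν p.pt) (τ p.pt) /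
    Ψ p.pt (Matrix.vecCons (ν p.pt) (τ p.pt)) = _
  have h0 := h.normalCoord_ne_zero hp
  have h1 := h.ne_zero p.pt hp
  rw [residueForm_apply, map_smul, h.ds_ν p.pt hp, ← ContinuousAlternatingMap.curryLeft_apply_apply,
    map_smul, ContinuousAlternatingMap.smul_apply,
    ContinuousAlternatingMap.curryLeft_apply_apply, zpow_neg, zpow_natCast, smul_eq_mul,
    smul_eq_mul, mul_one]
  obtain ⟨k, rfl⟩ : ∃ k, α = k + 1 := ⟨α - 1, by omega⟩
  rw [Nat.add_sub_cancel]
  field_simp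
  ring

theorem continuousOn_normalCoord (h : IsLocalFrame Ω α c V s Ψ ν τ) :
    ContinuousOn (normalCoord c.1 D s) (NormalPt.pt ⁻¹' V) := by
  refine continuousOn_of_coinduced rfl (h.isOpen.preimage (NormalPt.continuous_pt c.1 D)) ?_
  have h1 : ContinuousOn (fun p : {p : CSpace (m + 1) × CSpace (m + 1) //
      p.1 ∈ c.1.pre D ∧ p.2 ∉ tangentTo (c.1.pre D) p.1} => fderiv ℂ s p.1.1 p.1.2)
      (NormalPt.ofVec ⁻¹' (NormalPt.pt ⁻¹' V)) :=
    (h.cont_ds.comp (continuous_fst.comp continuous_subtype_val).continuousOn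
      fun p hp => hp).clm_apply (continuous_snd.comp continuous_subtype_val).continuousOn
  exact h1.congr fun p hp => h.normalCoord_eq (p := NormalPt.ofVec p) hp rfl

theorem continuousOn_canonCoord (h : IsLocalFrame Ω α c V s Ψ ν τ) :
    ContinuousOn (canonCoord c.1 D Ψ ν τ) (CanonPt.pt ⁻¹' V) := by
  refine continuousOn_of_coinduced rfl (h.isOpen.preimage (CanonPt.continuous_pt c.1 D)) ?_
  have hpt : Continuous fun p : {p : CSpace (m + 1) × (CSpace (m + 1)) [⋀^Fin m]→L[ℂ] ℂ //
      p.1 ∈ c.1.pre D ∧ restrictForm c.1 D p.1 p.2 ≠ 0} => p.1.1 :=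
    continuous_fst.comp continuous_subtype_val
  have h1 : ContinuousOn (fun p : {p : CSpace (m + 1) × (CSpace (m + 1)) [⋀^Fin m]→L[ℂ] ℂ //
      p.1 ∈ c.1.pre D ∧ restrictForm c.1 D p.1 p.2 ≠ 0} =>
        p.1.2 (τ p.1.1) / Ψ p.1.1 (Matrix.vecCons (ν p.1.1) (τ p.1.1)))
      (CanonPt.ofForm ⁻¹' (CanonPt.pt ⁻¹' V)) := by
    refine ContinuousOn.div ?_ ?_ fun p hp => h.ne_zero _ hp
    · exact (continuous_snd.comp continuous_subtype_val).continuousOn.eval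
        (h.cont_τ.comp hpt.continuousOn fun p hp => hp)
    · exact (h.cont_Ψ.comp hpt.continuousOn fun p hp => hp).eval
        ((continuousOn_vecCons h.cont_ν h.cont_τ).comp hpt.continuousOn fun p hp => hp)
  exact h1.congr fun p hp => h.canonCoord_eq (y := CanonPt.ofForm p) hp

/-- Over the domain of a frame, the residue map is a covering with `α - 1` sheets. -/
theorem isCoveringMap_restrict (hΩ : Ω.BlowsUpToOrder α) (h : IsLocalFrame Ω α c V s Ψ ν τ)
    (hα : 2 ≤ α) :
    IsCoveringMap ((CanonPt.pt ⁻¹' V).restrictPreimage (residueLift hΩ c)) ∧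
      ∀ y, Nat.card ((CanonPt.pt ⁻¹' V).restrictPreimage (residueLift hΩ c) ⁻¹' {y}) = α - 1 := by
  set B : Set (CanonPt c.1 D) := CanonPt.pt ⁻¹' V with hB
  -- The lift is the pullback of `P` along the fibre coordinate `k`; the inverse `r` sends `(y, a)`
  -- to the class of `a • ν` at the base point of `y`.
  let P : {x : ℂ // x ≠ 0} → {x : ℂ // x ≠ 0} := fun x =>
    ⟨x ^ (-((α - 1 : ℕ) : ℤ)), zpow_ne_zero _ x.2⟩
  have hP : IsCoveringMap P := isCoveringMap_zpow _ (by
    have : α - 1 ≠ 0 := by omega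
    push_cast
    simpa using this)
  let l : residueLift hΩ c ⁻¹' B → {x : ℂ // x ≠ 0} := fun e =>
    ⟨normalCoord c.1 D s e.1, h.normalCoord_ne_zero e.2⟩
  have hl : Continuous l := (h.continuousOn_normalCoord.comp_continuous continuous_subtype_val
    fun e => e.2).subtype_mk _
  let k : B → {x : ℂ // x ≠ 0} := fun y => ⟨canonCoord c.1 D Ψ ν τ y.1, h.canonCoord_ne_zero y.2⟩
  have hk : Continuous k := (h.continuousOn_canonCoord.comp_continuous continuous_subtype_val
    fun e => e.2).subtype_mk _
  let r : B × {x : ℂ // x ≠ 0} → residueLift hΩ c ⁻¹' B := fun q =>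
    ⟨NormalPt.ofVec ⟨(q.1.1.pt, (q.2 : ℂ) • ν q.1.1.pt), q.1.1.mem,
      h.smul_ν_notMem q.1.2 q.1.1.mem q.2.2⟩, q.1.2⟩
  have hpt : Continuous fun q : B × {x : ℂ // x ≠ 0} => q.1.1.pt :=
    (CanonPt.continuous_pt c.1 D).comp (continuous_subtype_val.comp continuous_fst)
  have hr : Continuous r := by
    refine Continuous.subtype_mk ((NormalPt.continuous_ofVec c.1 D).comp
      (Continuous.subtype_mk (hpt.prodMk ?_) _)) _
    exact (continuous_subtype_val.comp continuous_snd).smul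
      (h.cont_ν.comp_continuous hpt fun q => q.1.2)
  have hcomm : ∀ e, k (B.restrictPreimage (residueLift hΩ c) e) = P (l e) := fun e =>
    Subtype.ext (h.canonCoord_residueLift hΩ hα e.2)
  have hlr : ∀ y a, l (r (y, a)) = a := fun y a => by
    refine Subtype.ext ((h.normalCoord_eq (p := (r (y, a)).1) y.2 rfl).trans ?_)
    change fderiv ℂ s y.1.pt ((a : ℂ) • ν y.1.pt) = a
    rw [map_smul, h.ds_ν _ y.2, smul_eq_mul, mul_one]
  have hfr : ∀ y a, P a = k y → B.restrictPreimage (residueLift hΩ c) (r (y, a)) = y := by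
    intro y a hya
    refine Subtype.ext (h.canonPt_ext y.2 rfl ?_)
    have h1 : k (B.restrictPreimage (residueLift hΩ c) (r (y, a))) = k y := by
      rw [hcomm, hlr, hya]
    exact congrArg Subtype.val h1
  have hrf : ∀ e, r (B.restrictPreimage (residueLift hΩ c) e, l e) = e := by
    rintro ⟨⟨pt, mem, vec, hvec⟩, he⟩
    refine Subtype.ext ?_
    have h1 := h.vec_eq (p := ⟨pt, mem, vec, hvec⟩) he
    dsimp only at h1
    simp only [r, l, NormalPt.ofVec]
    congr 1
    exact h1.symm
  have hcont : Continuous (B.restrictPreimage (residueLift hΩ c)) :=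
    ((residueMap_isHolomorphic hΩ).continuous_lift c).restrictPreimage
  refine ⟨hP.of_pullback hcont hl hk hcomm hr hfr hlr hrf, fun y => ?_⟩
  rw [Nat.card_fiber_of_pullback hcomm hfr hlr hrf y]
  exact Complex.card_fiber_zpow (by omega) _

end IsLocalFrame

/-- Even covering is local on the target, and frames exist near every base point. -/
theorem isCoveringMap_residueLift (hΩ : Ω.BlowsUpToOrder α) (hα : 2 ≤ α) (c : O.atlas) :
    IsCoveringMap (residueLift hΩ c) ∧
      ∀ y, Nat.card (residueLift hΩ c ⁻¹' {y}) = α - 1 := by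
  have key : ∀ y, IsEvenlyCovered (residueLift hΩ c) y (residueLift hΩ c ⁻¹' {y}) ∧
      Nat.card (residueLift hΩ c ⁻¹' {y}) = α - 1 := by
    intro y
    obtain ⟨V, s, Ψ, ν, τ, hyV, hfr⟩ := hΩ.exists_isLocalFrame y.mem
    obtain ⟨h1, h2⟩ := hfr.isCoveringMap_restrict hΩ hα
    have hB := hfr.isOpen.preimage (CanonPt.continuous_pt c.1 D)
    refine ⟨IsCoveringMapOn.of_isCoveringMap_restrictPreimage _ hB
      (hB.preimage ((residueMap_isHolomorphic hΩ).continuous_lift c)) h1 y hyV, ?_⟩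
    rw [← h2 ⟨y, hyV⟩, Nat.card_fiber_restrictPreimage]
  exact ⟨fun y => (key y).1, fun y => (key y).2⟩

theorem residueMap_isUnbranchedCovering (hΩ : Ω.BlowsUpToOrder α) (hα : 2 ≤ α) :
    (residueMap hΩ).IsUnbranchedCovering (α - 1) := by
  refine ⟨(residueMap_isHolomorphic hΩ).continuous_toFun,
    NormalToCanonMap.surjective_toFun fun c y => ?_, isCoveringMap_residueLift hΩ hα⟩
  have h := (isCoveringMap_residueLift hΩ hα c).2 y
  have : Nonempty (residueLift hΩ c ⁻¹' {y}) := by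
    -- An empty fibre would have `0` points, but `α - 1 ≥ 1`.
    by_contra hne
    rw [not_nonempty_iff] at hne
    rw [Nat.card_of_isEmpty] at h
    omega
  obtain ⟨p, hp⟩ := this
  exact ⟨p, hp⟩

end Frame

/-! ### Composition and roofs of injections -/

section Comp

variable {X : Type u} [TopologicalSpace X] {n : ℕ} {c d e : OrbChart X n}
  {f g : CSpace n → CSpace n}

theorem IsInjection.comp (hg : IsInjection d e g) (hf : IsInjection c d f) :
    IsInjection c e (g ∘ f) where
  mapsTo := hg.mapsTo.comp hf.mapsTo
  holo := hg.holo.comp hf.holo hf.mapsTo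
  injOn := hg.injOn.comp hf.injOn hf.mapsTo
  immersion z hz := by
    rw [fderiv_comp z (hg.differentiableAt (hf.mapsTo hz)) (hf.differentiableAt hz)]
    exact (hg.immersion _ (hf.mapsTo hz)).comp (hf.immersion z hz)
  proj_comp z hz := (hg.proj_comp _ (hf.mapsTo hz)).trans (hf.proj_comp z hz)

/-- An injection can be composed with an element of the local uniformising group so that it hits a
prescribed point of the fibre. -/
theorem IsInjection.exists_apply_eq (hf : IsInjection c d f) {z w : CSpace n} (hz : z ∈ c.U)
    (hw : w ∈ d.U) (h : d.proj w = c.proj z) : ∃ f', IsInjection c d f' ∧ f' z = w := by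
  obtain ⟨γ, hγ, hγw⟩ := (d.proj_eq_iff (f z) (hf.mapsTo hz) w hw).1
    ((hf.proj_comp z hz).trans h.symm)
  exact ⟨γ ∘ f, (d.isInjection_of_mem hγ).comp hf, hγw⟩

/-- Two points over the same point of the orbifold are joined by a roof of injections. -/
theorem IsOrbAtlas.exists_roof {A : Set (OrbChart X n)} (hA : IsOrbAtlas A) (hc : c ∈ A)
    (hd : d ∈ A) {z w : CSpace n} (hz : z ∈ c.U) (hw : w ∈ d.U) (h : c.proj z = d.proj w) :
    ∃ e ∈ A, ∃ y ∈ e.U, (∃ f, IsInjection e c f ∧ f y = z) ∧ ∃ g, IsInjection e d g ∧ g y = w := by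
  obtain ⟨e, he, ⟨y, hy, hyz⟩, ⟨f, hf⟩, g, hg⟩ :=
    hA.compat c hc d hd (c.proj z) ⟨⟨z, hz, rfl⟩, ⟨w, hw, h.symm⟩⟩
  exact ⟨e, he, y, hy, hf.exists_apply_eq hy hz hyz.symm, hg.exists_apply_eq hy hw (by rw [hyz, h])⟩

end Comp

/-! ### The residue formula and uniqueness -/

section ResidueFormula

variable {X : Type u} [TopologicalSpace X] {m : ℕ} {O : ComplexOrbifold X (m + 1)} {D : Set X}
  {Ω : HolVolForm O D} {α : ℕ} {c d e : O.atlas} {z : CSpace (m + 1)}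
  {f g : CSpace (m + 1) → CSpace (m + 1)}

theorem residueMap_isResidueMap (hΩ : Ω.BlowsUpToOrder α) : (residueMap hΩ).IsResidueMap Ω α := by
  intro c _ s hs p v lam hlam hv hvec
  obtain ⟨V, -, -, hzV, t, -, Ψ, -, hdata⟩ := hΩ.exists_residueData p.mem
  obtain ⟨k, -, -, hd⟩ := (hdata p.pt hzV p.mem).change
    (hs.isLocalDefining c.1.isOpen_U p.mem.1 p.mem)
  refine ⟨rfl, fun u => ?_⟩
  rw [hd.clearedForm_eq]
  have h := residueLift_form hΩ hd (v := lam • v) hvec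
  have h2 := DFunLike.congr_fun h u
  refine h2.trans ?_
  change residueForm α s _ p.pt (lam • v) (fun i => (u i : CSpace (m + 1))) = _
  rw [residueForm_apply, map_smul, hv, ← ContinuousAlternatingMap.curryLeft_apply_apply,
    map_smul, ContinuousAlternatingMap.smul_apply, ContinuousAlternatingMap.curryLeft_apply_apply,
    smul_eq_mul, smul_eq_mul, mul_one, zpow_sub₀ hlam, zpow_one, zpow_natCast, ← mul_assoc,
    div_eq_inv_mul]

theorem OrbChart.IsAdapted.exists_definingFunction {c : OrbChart X (m + 1)}
    (h : c.IsAdapted D α) : ∃ s, IsDefiningFunctionOn (c.pre D) c.U s := by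
  obtain ⟨ζ, hζ, -, himm, hD, -⟩ := h
  refine ⟨fun w => ζ w (Fin.last m), differentiableOn_pi.1 hζ _, fun z hz => ?_, fun z hz _ h0 => ?_⟩
  · rw [← hD z hz]
    exact ⟨fun h => ⟨hz, h⟩, fun h => h.2⟩
  · have hd : DifferentiableAt ℂ ζ z := hζ.differentiableAt (c.isOpen_U.mem_nhds hz)
    obtain ⟨v, hv⟩ := surjective_of_injective_clm (himm z hz) (Pi.single (Fin.last m) 1)
    have h1 := (hasFDerivAt_pi'.1 hd.hasFDerivAt (Fin.last m)).fderiv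
    rw [h0] at h1
    have h2 := DFunLike.congr_fun h1 v
    simp [hv] at h2

/-- The formula reaches every normal vector: with `λ = ds(v)`, the vector `λ⁻¹ • v` represents
`∂/∂s`. -/
theorem NormalToCanonMap.IsResidueMap.lift_eq_of_isAdapted
    {φ ψ : NormalToCanonMap O D} (hφ : φ.IsResidueMap Ω α) (hψ : ψ.IsResidueMap Ω α)
    (hc : c.1.IsAdapted D α) (p : NormalPt c.1 D) : φ.lift c p = ψ.lift c p := by
  obtain ⟨s, hs⟩ := hc.exists_definingFunction
  obtain ⟨v, hv⟩ := Submodule.Quotient.mk_surjective _ p.vec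
  have hloc := hs.isLocalDefining c.1.isOpen_U p.mem.1 p.mem
  have hlam : fderiv ℂ s p.pt v ≠ 0 := fun h =>
    NormalPt.notMem_of_vec_eq hv.symm (hloc.mem_tangentTo.2 h)
  have h1 : fderiv ℂ s p.pt ((fderiv ℂ s p.pt v)⁻¹ • v) = 1 := by
    rw [map_smul, smul_eq_mul, inv_mul_cancel₀ hlam]
  have h2 : p.vec = fderiv ℂ s p.pt v •
      (Submodule.Quotient.mk ((fderiv ℂ s p.pt v)⁻¹ • v) :
        CSpace (m + 1) ⧸ tangentTo (c.1.pre D) p.pt) := by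
    rw [← Submodule.Quotient.mk_smul, smul_smul, mul_inv_cancel₀ hlam, one_smul, hv]
  obtain ⟨hφ1, hφ2⟩ := hφ c hc s hs p _ _ hlam h1 h2
  obtain ⟨hψ1, hψ2⟩ := hψ c hc s hs p _ _ hlam h1 h2
  refine CanonPt.ext_of_apply (hφ1.trans hψ1.symm) fun u u' huu' => ?_
  rw [hφ2, hψ2]
  simp only [huu']

/-- The two tangent spaces are the kernels of `ds` and of `d(s ∘ f) = ds ∘ df`. -/
theorem HolVolForm.BlowsUpToOrder.fderiv_mem_tangentTo_iff (hΩ : Ω.BlowsUpToOrder α)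
    (hf : IsInjection c.1 d.1 f) (hz : z ∈ c.1.pre D) {v : CSpace (m + 1)} :
    fderiv ℂ f z v ∈ tangentTo (d.1.pre D) (f z) ↔ v ∈ tangentTo (c.1.pre D) z := by
  obtain ⟨V, -, -, hzV, s, -, Ψ, -, hdata⟩ := hΩ.exists_residueData ((hf.mem_pre_iff hz.1).2 hz)
  have hd := hdata _ hzV ((hf.mem_pre_iff hz.1).2 hz)
  rw [hd.loc.mem_tangentTo, (hd.pullback hf hz.1).loc.mem_tangentTo,
    fderiv_comp z hd.loc.holo.self_of_nhds (hf.differentiableAt hz.1)]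
  rfl

/-- As `f` is injective and `df` maps tangent vectors of `D̃` to tangent vectors, the form at the
target determines its pullback. -/
theorem CanonRel.left_unique (hΩ : Ω.BlowsUpToOrder α) (hf : IsInjection c.1 d.1 f)
    {y y' : CanonPt c.1 D} {q : CanonPt d.1 D} (h : CanonRel f y q) (h' : CanonRel f y' q) :
    y = y' := by
  obtain ⟨qpt, qmem, η, hη⟩ := q
  obtain ⟨ypt, ymem, θ, hθ⟩ := y
  obtain ⟨ypt', ymem', θ', hθ'⟩ := y'
  obtain ⟨h1, h2⟩ := h
  obtain ⟨h1', h2'⟩ := h'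
  dsimp only at h1 h2 h1' h2'
  obtain rfl : ypt = ypt' := hf.injOn ymem.1 ymem'.1 (h1.symm.trans h1')
  subst h1
  obtain rfl : θ = θ' := by
    ext u
    let u' : Fin m → tangentTo (d.1.pre D) (f ypt) := fun i =>
      ⟨fderiv ℂ f ypt (u i), (hΩ.fderiv_mem_tangentTo_iff hf ymem).2 (u i).2⟩
    exact (h2 u u' fun _ => rfl).symm.trans (h2' u u' fun _ => rfl)
  rfl

theorem CanonRel.right_unique (hΩ : Ω.BlowsUpToOrder α) (hf : IsInjection c.1 d.1 f)
    {y : CanonPt c.1 D} {q q' : CanonPt d.1 D} (h : CanonRel f y q) (h' : CanonRel f y q') :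
    q = q' := by
  obtain ⟨qpt, qmem, η, hη⟩ := q
  obtain ⟨qpt', qmem', η', hη'⟩ := q'
  obtain ⟨h1, h2⟩ := h
  obtain ⟨h1', h2'⟩ := h'
  dsimp only at h1 h2 h1' h2'
  subst h1
  subst h1'
  obtain rfl : η = η' := by
    ext u'
    choose w hw using fun i => hf.surjective_fderiv y.mem.1 (u' i : CSpace (m + 1))
    let u : Fin m → tangentTo (c.1.pre D) y.pt := fun i =>
      ⟨w i, (hΩ.fderiv_mem_tangentTo_iff hf y.mem).1 (by rw [hw]; exact (u' i).2)⟩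
    exact (h2 u u' fun i => (hw i).symm).trans (h2' u u' fun i => (hw i).symm).symm
  rfl

theorem HolVolForm.BlowsUpToOrder.exists_normalRel_left (hΩ : Ω.BlowsUpToOrder α)
    (hf : IsInjection c.1 d.1 f) (q : NormalPt d.1 D) (hz : z ∈ c.1.U) (h : f z = q.pt) :
    ∃ p : NormalPt c.1 D, NormalRel f p q := by
  obtain ⟨v', hv'⟩ := Submodule.Quotient.mk_surjective _ q.vec
  obtain ⟨v, hv⟩ := hf.surjective_fderiv hz v'
  have hzD : z ∈ c.1.pre D := (hf.mem_pre_iff hz).1 (h ▸ q.mem)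
  refine ⟨NormalPt.ofVec ⟨(z, v), hzD, fun hmem => ?_⟩, h.symm, v, rfl, ?_⟩
  · have h1 := (hΩ.fderiv_mem_tangentTo_iff hf hzD).2 hmem
    rw [hv, h] at h1
    exact NormalPt.notMem_of_vec_eq hv'.symm h1
  · change q.vec = Submodule.Quotient.mk (fderiv ℂ f z v)
    rw [hv, hv']

theorem HolVolForm.BlowsUpToOrder.exists_normalRel_right (hΩ : Ω.BlowsUpToOrder α)
    (hf : IsInjection c.1 d.1 f) (p : NormalPt c.1 D) : ∃ q : NormalPt d.1 D, NormalRel f p q := by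
  obtain ⟨v, hv⟩ := Submodule.Quotient.mk_surjective _ p.vec
  exact ⟨NormalPt.ofVec ⟨(f p.pt, fderiv ℂ f p.pt v), (hf.mem_pre_iff p.mem.1).2 p.mem, fun hmem =>
    NormalPt.notMem_of_vec_eq hv.symm ((hΩ.fderiv_mem_tangentTo_iff hf p.mem).1 hmem)⟩,
    rfl, v, hv.symm, rfl⟩

theorem NormalToCanonMap.ext_of_lift {φ ψ : NormalToCanonMap O D}
    (h : ∀ c p, φ.lift c p = ψ.lift c p) : φ = ψ := by
  obtain ⟨F, l, hF, hl⟩ := φ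
  obtain ⟨G, k, hG, hk⟩ := ψ
  obtain rfl : l = k := funext fun c => funext fun p => h c p
  obtain rfl : F = G := funext fun x => by
    obtain ⟨c, p⟩ := x
    exact (hF c p).trans (hG c p).symm
  rfl

/-- An orbifold map is determined by the residue formula in the adapted charts. -/
theorem NormalToCanonMap.IsResidueMap.unique (hΩ : Ω.BlowsUpToOrder α)
    (hbasic : O.BasicAssumption D α) {φ ψ : NormalToCanonMap O D} (hφ : φ.IsResidueMap Ω α)
    (hψ : ψ.IsResidueMap Ω α) : φ = ψ := by
  refine NormalToCanonMap.ext_of_lift fun c p => ?_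
  obtain ⟨d, hd, ⟨w, hw, hwx⟩, had⟩ := hbasic _ p.mem.2
  obtain ⟨e, he, y, hy, ⟨f, hf, hfy⟩, g, hg, -⟩ :=
    O.isAtlas.exists_roof c.2 hd p.mem.1 hw hwx.symm
  lift e to O.atlas using he
  lift d to O.atlas using hd
  obtain ⟨r, hr⟩ := hΩ.exists_normalRel_left hf p hy hfy
  obtain ⟨q, hq⟩ := hΩ.exists_normalRel_right hg r
  -- Agreement at `q` in the adapted chart descends along `g` to `r` in the roof, then ascends along
  -- `f` to `p`.
  have h1 := hφ.lift_eq_of_isAdapted hψ had q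
  have h2 : φ.lift e r = ψ.lift e r :=
    CanonRel.left_unique hΩ hg (φ.compat e d g hg r q hq) (h1 ▸ ψ.compat e d g hg r q hq)
  exact CanonRel.right_unique hΩ hf (φ.compat e c f hf r p hr) (h2 ▸ ψ.compat e c f hf r p hr)

end ResidueFormula

/-! ### Germs of transition maps between charts -/

section Transition

open Filter

variable {X : Type u} [TopologicalSpace X] {n : ℕ} {c d e : OrbChart X n}
  {f g h k : CSpace n → CSpace n} {z : CSpace n} {D : Set X}

/-- `h` is a germ at `z` of a biholomorphic map from the chart `c` to the chart `d` over `X`. -/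
structure IsTransition (c d : OrbChart X n) (z : CSpace n) (h : CSpace n → CSpace n) : Prop where
  holo : ∀ᶠ w in 𝓝 z, DifferentiableAt ℂ h w
  mem : ∀ᶠ w in 𝓝 z, h w ∈ d.U
  proj : ∀ᶠ w in 𝓝 z, d.proj (h w) = c.proj w
  inj : Function.Injective (fderiv ℂ h z)

theorem IsInjection.isTransition (hf : IsInjection c d f) (hz : z ∈ c.U) :
    IsTransition c d z f where
  holo := hf.eventually_differentiableAt hz
  mem := by filter_upwards [c.isOpen_U.mem_nhds hz] with w hw using hf.mapsTo hw
  proj := by filter_upwards [c.isOpen_U.mem_nhds hz] with w hw using hf.proj_comp w hw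
  inj := hf.immersion z hz

theorem IsTransition.differentiableAt (hh : IsTransition c d z h) : DifferentiableAt ℂ h z :=
  hh.holo.self_of_nhds

theorem IsTransition.tendsto (hh : IsTransition c d z h) : Tendsto h (𝓝 z) (𝓝 (h z)) :=
  hh.differentiableAt.continuousAt

theorem IsTransition.comp (hk : IsTransition d e (h z) k) (hh : IsTransition c d z h) :
    IsTransition c e z (k ∘ h) where
  holo := by
    filter_upwards [hh.holo, hh.tendsto.eventually hk.holo] with w h1 h2 using h2.comp w h1
  mem := hh.tendsto.eventually hk.mem
  proj := by
    filter_upwards [hh.proj, hh.tendsto.eventually hk.proj] with w h1 h2 using h2.trans h1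
  inj := by
    rw [fderiv_comp z hk.differentiableAt hh.differentiableAt]
    exact hk.inj.comp hh.inj

/-- Invertibility of the derivative is an open condition. Thus one germ computes the extended form
on a whole neighbourhood. -/
theorem IsTransition.eventually (hh : IsTransition c d z h) :
    ∀ᶠ w in 𝓝 z, IsTransition c d w h := by
  let E := ContinuousLinearEquiv.ofBijective (fderiv ℂ h z) (LinearMap.ker_eq_bot.2 hh.inj)
    (LinearMap.range_eq_top.2 (surjective_of_injective_clm hh.inj))
  have hE : (E : CSpace n →L[ℂ] CSpace n) = fderiv ℂ h z :=
    ContinuousLinearEquiv.coe_ofBijective _ _ _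
  have h1 : ∀ᶠ w in 𝓝 z, fderiv ℂ h w ∈
      Set.range ((↑) : (CSpace n ≃L[ℂ] CSpace n) → CSpace n →L[ℂ] CSpace n) :=
    (differentiableAt_fderiv_of_eventually hh.holo).continuousAt.eventually
      (hE ▸ ContinuousLinearEquiv.nhds E)
  filter_upwards [h1, hh.holo.eventually_nhds, hh.mem.eventually_nhds, hh.proj.eventually_nhds]
    with w ⟨L, hL⟩ h2 h3 h4
  exact ⟨h2, h3, h4, by rw [← hL]; exact L.injective⟩

theorem IsTransition.mem_pre_iff (hh : IsTransition c d z h) (hz : z ∈ c.U) :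
    h z ∈ d.pre D ↔ z ∈ c.pre D := by
  simp [OrbChart.pre, hz, hh.mem.self_of_nhds, hh.proj.self_of_nhds]

/-- By the inverse function theorem an injection can be reversed as a germ; this turns roofs into
transitions. -/
theorem IsInjection.exists_inverse (hf : IsInjection c d f) (hz : z ∈ c.U) :
    ∃ h, IsTransition d c (f z) h ∧ h (f z) = z := by
  let E := ContinuousLinearEquiv.ofBijective (fderiv ℂ f z)
    (LinearMap.ker_eq_bot.2 (hf.immersion z hz)) (LinearMap.range_eq_top.2 (hf.surjective_fderiv hz))
  have hE : (E : CSpace n →L[ℂ] CSpace n) = fderiv ℂ f z :=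
    ContinuousLinearEquiv.coe_ofBijective _ _ _
  have hc : ContDiffAt ℂ 1 f z :=
    contDiffAt_of_eventually_differentiableAt (hf.eventually_differentiableAt hz) 1
  have hd : HasFDerivAt f (E : CSpace n →L[ℂ] CSpace n) z := by
    rw [hE]; exact (hf.differentiableAt hz).hasFDerivAt
  have hs : HasStrictFDerivAt f (E : CSpace n →L[ℂ] CSpace n) z :=
    hc.hasStrictFDerivAt' hd one_ne_zero
  let h := hc.localInverse hd one_ne_zero
  have hcd : ContDiffAt ℂ 1 h (f z) := hc.to_localInverse hd one_ne_zero
  have hfz : h (f z) = z := hc.localInverse_apply_image hd one_ne_zero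
  have hright : ∀ᶠ w in 𝓝 (f z), f (h w) = w := hs.eventually_right_inverse
  have hmem : ∀ᶠ w in 𝓝 (f z), h w ∈ c.U :=
    hcd.continuousAt.eventually (by rw [hfz]; exact c.isOpen_U.mem_nhds hz)
  refine ⟨h, ⟨?_, hmem, ?_, ?_⟩, hfz⟩
  · filter_upwards [hcd.eventually (by simp)] with w hw using hw.differentiableAt one_ne_zero
  · filter_upwards [hright, hmem] with w h1 h2
    rw [← hf.proj_comp _ h2, h1]
  · have h1 : fderiv ℂ (f ∘ h) (f z) = ContinuousLinearMap.id ℂ (CSpace n) := by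
      have h2 : f ∘ h =ᶠ[𝓝 (f z)] id := hright
      rw [h2.fderiv_eq, fderiv_id]
    rw [fderiv_comp _ (by rw [hfz]; exact hf.differentiableAt hz)
      (hcd.differentiableAt one_ne_zero)] at h1
    intro v w hvw
    have hv := DFunLike.congr_fun h1 v
    have hw := DFunLike.congr_fun h1 w
    simp only [ContinuousLinearMap.comp_apply, ContinuousLinearMap.id_apply] at hv hw
    rw [← hv, ← hw, hvw]

theorem IsOrbAtlas.exists_transition {A : Set (OrbChart X n)} (hA : IsOrbAtlas A) (hc : c ∈ A)
    (hd : d ∈ A) {w : CSpace n} (hz : z ∈ c.U) (hw : w ∈ d.U) (hzw : c.proj z = d.proj w) :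
    ∃ h, IsTransition c d z h ∧ h z = w := by
  obtain ⟨e, -, y, hy, ⟨f, hf, rfl⟩, g, hg, rfl⟩ := hA.exists_roof hc hd hz hw hzw
  obtain ⟨h, hh, hhy⟩ := hf.exists_inverse hy
  exact ⟨g ∘ h, (show IsTransition e d (h (f y)) g from hhy.symm ▸ hg.isTransition hy).comp hh,
    congrArg g hhy⟩

/-- Transition germs to a point with trivial isotropy group are unique. -/
theorem IsTransition.eventuallyEq (hh : IsTransition c d z h) (hk : IsTransition c d z k)
    (hzhk : h z = k z) (hiso : ∀ γ ∈ d.Γ, γ (h z) = h z → γ = 1) : h =ᶠ[𝓝 z] k := by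
  have := d.finite_Γ
  -- Pointwise, `h` and `k` differ by some `γ`. Each of the finitely many `γ ≠ 1` separates `γ (h
  -- z)` from `k z`, hence also nearby, which leaves `γ = 1`.
  have h1 : ∀ᶠ w in 𝓝 z, ∀ γ : d.Γ, (γ : Equiv.Perm (CSpace n)) ≠ 1 → γ.1 (h w) ≠ k w := by
    rw [eventually_all]
    intro γ
    by_cases hγ : (γ : Equiv.Perm (CSpace n)) = 1
    · exact Eventually.of_forall fun w hne => absurd hγ hne
    have hne : γ.1 (h z) ≠ k z := fun h2 => hγ (hiso γ.1 γ.2 (h2.trans hzhk.symm))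
    have hγc : ContinuousAt γ.1 (h z) := ((d.act_holo γ.1 γ.2).differentiableAt
      (d.isOpen_U.mem_nhds hh.mem.self_of_nhds)).continuousAt
    have h3 : Tendsto (fun w => γ.1 (h w)) (𝓝 z) (𝓝 (γ.1 (h z))) := hγc.tendsto.comp hh.tendsto
    filter_upwards [(h3.prodMk_nhds hk.tendsto).eventually
      ((isOpen_ne_fun continuous_fst continuous_snd).mem_nhds hne)] with w hw _ using hw
  filter_upwards [h1, hh.mem, hk.mem, hh.proj, hk.proj] with w h2 h3 h4 h5 h6
  obtain ⟨γ, hγ, hγw⟩ := (d.proj_eq_iff _ h3 _ h4).1 (h5.trans h6.symm)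
  by_cases h7 : γ = 1
  · rw [← hγw, h7]; rfl
  · exact absurd hγw (h2 ⟨γ, hγ⟩ h7)

end Transition

/-! ### Extending an invariant form from a subatlas to all charts -/

section ExtendForm

open Filter

variable {X : Type u} [TopologicalSpace X] {m : ℕ} {O : ComplexOrbifold X (m + 1)} {D : Set X}
  {A : Set (OrbChart X (m + 1))} {c d : OrbChart X (m + 1)} {z : CSpace (m + 1)}
  {h : CSpace (m + 1) → CSpace (m + 1)}
  {G : OrbChart X (m + 1) → CSpace (m + 1) → (CSpace (m + 1)) [⋀^Fin (m + 1)]→L[ℂ] ℂ}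

theorem ComplexOrbifold.isotropy_trivial (hsing : O.singularSet ⊆ D) (hc : c ∈ O.atlas)
    (hz : z ∈ c.U \ c.pre D) : ∀ γ ∈ c.Γ, γ z = z → γ = 1 := fun γ hγ hγz => by
  by_contra hne
  exact hz.2 ⟨hz.1, hsing ⟨c, hc, z, hz.1, rfl, γ, hγ, hne, hγz⟩⟩

theorem IsTransition.mem_diff (hh : IsTransition c d z h) (hz : z ∈ c.U \ c.pre D) :
    h z ∈ d.U \ d.pre D :=
  ⟨hh.mem.self_of_nhds, fun hmem => hz.2 ((hh.mem_pre_iff hz.1).1 hmem)⟩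

/-- The forms `G` on the charts of the atlas `A` are compatible with all injections off `D`. -/
def IsInvariantFamily (A : Set (OrbChart X (m + 1))) (D : Set X)
    (G : OrbChart X (m + 1) → CSpace (m + 1) → (CSpace (m + 1)) [⋀^Fin (m + 1)]→L[ℂ] ℂ) : Prop :=
  ∀ c ∈ A, ∀ d ∈ A, ∀ f, IsInjection c d f → ∀ z ∈ c.U \ c.pre D,
    (G d (f z)).compContinuousLinearMap (fderiv ℂ f z) = G c z

theorem ContinuousAlternatingMap.compContinuousLinearMap_comp {E : Type*} [AddCommGroup E]
    [Module ℂ E] [TopologicalSpace E] {ι : Type*} (η : E [⋀^ι]→L[ℂ] ℂ) (L L' : E →L[ℂ] E) :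
    η.compContinuousLinearMap (L.comp L') =
      (η.compContinuousLinearMap L).compContinuousLinearMap L' := rfl

/-- Both transitions factor, as germs, through one transition `k` to the apex of a roof in `A`,
because isotropy off `D` is trivial; invariance along the two legs then gives the same form. -/
theorem IsInvariantFamily.eq_of_transition (hG : IsInvariantFamily A D G)
    (hsing : O.singularSet ⊆ D) (hAO : A ⊆ O.atlas) (hA : IsOrbAtlas A) (hc : c ∈ O.atlas)
    (hz : z ∈ c.U \ c.pre D) {d d' : OrbChart X (m + 1)} (hd : d ∈ A) (hd' : d' ∈ A)
    {h h' : CSpace (m + 1) → CSpace (m + 1)} (hh : IsTransition c d z h)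
    (hh' : IsTransition c d' z h') :
    (G d (h z)).compContinuousLinearMap (fderiv ℂ h z) =
      (G d' (h' z)).compContinuousLinearMap (fderiv ℂ h' z) := by
  obtain ⟨e, he, y, hy, ⟨f, hf, hfy⟩, f', hf', hfy'⟩ := hA.exists_roof hd hd'
    hh.mem.self_of_nhds hh'.mem.self_of_nhds (hh.proj.self_of_nhds.trans hh'.proj.self_of_nhds.symm)
  have hyz : c.proj z = e.proj y := by
    rw [← hf.proj_comp y hy, hfy, hh.proj.self_of_nhds]
  obtain ⟨k, hk, hky⟩ := O.isAtlas.exists_transition hc (hAO he) hz.1 hy hyz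
  have key : ∀ {d : OrbChart X (m + 1)} {h f : CSpace (m + 1) → CSpace (m + 1)}, d ∈ A →
      IsTransition c d z h → IsInjection e d f → f y = h z →
      (G d (h z)).compContinuousLinearMap (fderiv ℂ h z) =
        (G e y).compContinuousLinearMap (fderiv ℂ k z) := by
    intro d h f hd hh hf hfy
    have hfk : IsTransition c d z (f ∘ k) :=
      (show IsTransition e d (k z) f from hky.symm ▸ hf.isTransition hy).comp hk
    have heq : h =ᶠ[𝓝 z] f ∘ k := hh.eventuallyEq hfk (by simp [hky, hfy])
      (O.isotropy_trivial hsing (hAO hd) (hh.mem_diff hz))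
    have hyD : y ∈ e.U \ e.pre D := by
      have := hk.mem_diff hz
      rwa [hky] at this
    rw [heq.fderiv_eq, fderiv_comp z (by rw [hky]; exact hf.differentiableAt hy)
      hk.differentiableAt, ContinuousAlternatingMap.compContinuousLinearMap_comp, hky, ← hfy,
      hG e he d hd f hf y hyD]
  rw [key hd hh hf hfy, key hd' hh' hf' hfy']

open Classical in
/-- The extension of an invariant family of forms to all charts of the orbifold. -/
noncomputable def extendForm (A : Set (OrbChart X (m + 1)))
    (G : OrbChart X (m + 1) → CSpace (m + 1) → (CSpace (m + 1)) [⋀^Fin (m + 1)]→L[ℂ] ℂ)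
    (c : OrbChart X (m + 1)) (z : CSpace (m + 1)) : (CSpace (m + 1)) [⋀^Fin (m + 1)]→L[ℂ] ℂ :=
  if H : ∃ p : OrbChart X (m + 1) × (CSpace (m + 1) → CSpace (m + 1)),
      p.1 ∈ A ∧ IsTransition c p.1 z p.2 then
    (G H.choose.1 (H.choose.2 z)).compContinuousLinearMap (fderiv ℂ H.choose.2 z)
  else 0

theorem IsInvariantFamily.extendForm_eq (hG : IsInvariantFamily A D G)
    (hsing : O.singularSet ⊆ D) (hAO : A ⊆ O.atlas) (hA : IsOrbAtlas A) (hc : c ∈ O.atlas)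
    (hz : z ∈ c.U \ c.pre D) (hd : d ∈ A) (hh : IsTransition c d z h) :
    extendForm A G c z = (G d (h z)).compContinuousLinearMap (fderiv ℂ h z) := by
  have H : ∃ p : OrbChart X (m + 1) × (CSpace (m + 1) → CSpace (m + 1)),
      p.1 ∈ A ∧ IsTransition c p.1 z p.2 := ⟨(d, h), hd, hh⟩
  rw [extendForm, dif_pos H]
  exact hG.eq_of_transition hsing hAO hA hc hz H.choose_spec.1 hd H.choose_spec.2 hh

theorem ComplexOrbifold.exists_transition_to (hAO : A ⊆ O.atlas) (hA : IsOrbAtlas A)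
    (hc : c ∈ O.atlas) (hz : z ∈ c.U) : ∃ d ∈ A, ∃ h, IsTransition c d z h := by
  obtain ⟨d, hd, w, hw, hwz⟩ := hA.cover (c.proj z)
  obtain ⟨h, hh, -⟩ := O.isAtlas.exists_transition hc (hAO hd) hz hw hwz.symm
  exact ⟨d, hd, h, hh⟩

/-- An invariant family of holomorphic volume forms on the charts of an atlas extends to a
holomorphic volume form of the orbifold. -/
noncomputable def IsInvariantFamily.volForm (hG : IsInvariantFamily A D G)
    (hsing : O.singularSet ⊆ D) (hAO : A ⊆ O.atlas) (hA : IsOrbAtlas A)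
    (hholo : ∀ d ∈ A, ∀ w ∈ d.U \ d.pre D, DifferentiableAt ℂ (G d) w)
    (hne : ∀ d ∈ A, ∀ w ∈ d.U \ d.pre D, G d w ≠ 0) : HolVolForm O D where
  form c := extendForm A G c
  holo c z hz := by
    obtain ⟨d, hd, h, hh⟩ := O.exists_transition_to hAO hA c.2 hz.1
    have h1 : DifferentiableAt ℂ (fun w => (G d (h w)).compContinuousLinearMap (fderiv ℂ h w)) z :=
      ((hholo d hd _ (hh.mem_diff hz)).comp z
        hh.differentiableAt).continuousAlternatingMapCompContinuousLinearMap
        (differentiableAt_fderiv_of_eventually hh.holo)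
    refine h1.differentiableWithinAt.congr_of_eventuallyEq ?_
      (hG.extendForm_eq hsing hAO hA c.2 hz hd hh)
    filter_upwards [self_mem_nhdsWithin, nhdsWithin_le_nhds hh.eventually] with w hw hhw
      using hG.extendForm_eq hsing hAO hA c.2 hw hd hhw
  ne_zero c z hz h0 := by
    obtain ⟨d, hd, h, hh⟩ := O.exists_transition_to hAO hA c.2 hz.1
    rw [hG.extendForm_eq hsing hAO hA c.2 hz hd hh] at h0
    refine hne d hd _ (hh.mem_diff hz) (ContinuousAlternatingMap.ext fun v => ?_)
    choose w hw using surjective_of_injective_clm hh.inj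
    have := DFunLike.congr_fun h0 (fun i => w (v i))
    simpa [Function.comp_def, hw] using this
  invariant c c' f hf z hz := by
    have hfz : f z ∈ c'.1.U \ c'.1.pre D := (hf.isTransition hz.1).mem_diff hz
    obtain ⟨d, hd, h, hh⟩ := O.exists_transition_to hAO hA c'.2 hfz.1
    rw [hG.extendForm_eq hsing hAO hA c'.2 hfz hd hh,
      hG.extendForm_eq hsing hAO hA c.2 hz hd (hh.comp (hf.isTransition hz.1)),
      fderiv_comp z hh.differentiableAt (hf.differentiableAt hz.1)]
    rfl

end ExtendForm

/-! ### The standard volume form -/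

section StandardForm

/-- The standard volume form `dz₁ ∧ ⋯ ∧ dzₙ`. -/
noncomputable def stdVol (n : ℕ) : (CSpace n) [⋀^Fin n]→L[ℂ] ℂ where
  toMultilinearMap := (Pi.basisFun ℂ (Fin n)).det.toMultilinearMap
  cont := by
    rw [Pi.basisFun_det]
    exact (continuous_id (X := Fin n → Fin n → ℂ)).matrix_det
  map_eq_zero_of_eq' := (Pi.basisFun ℂ (Fin n)).det.map_eq_zero_of_eq'

theorem stdVol_ne_zero (n : ℕ) : stdVol n ≠ 0 := fun h => by
  have h1 : stdVol n (Pi.basisFun ℂ (Fin n)) = 1 := (Pi.basisFun ℂ (Fin n)).det_self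
  rw [h] at h1
  exact zero_ne_one h1

theorem stdVol_comp (n : ℕ) (L : CSpace n →L[ℂ] CSpace n) :
    (stdVol n).compContinuousLinearMap L = L.det • stdVol n :=
  ContinuousAlternatingMap.ext fun v => (Pi.basisFun ℂ (Fin n)).det_comp L.toLinearMap v

end StandardForm

/-! ### The volume form given by the isomorphism of line bundles -/

section Existence

open Filter

variable {X : Type u} [TopologicalSpace X] {m : ℕ} {O : ComplexOrbifold X (m + 1)} {D : Set X}
  {α : ℕ}

/-- An isomorphism `-K_X = α[D]` gives a volume form on `X \ D` that blows up to order `α`. -/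
theorem ComplexOrbifold.AnticanonicalEq.exists_volForm (hKD : O.AnticanonicalEq D α)
    (hsing : O.singularSet ⊆ D) : ∃ Ω : HolVolForm O D, Ω.BlowsUpToOrder α := by
  obtain ⟨A, hAO, hA, s, hs, θ, hθ, htrans⟩ := hKD
  let G : OrbChart X (m + 1) → CSpace (m + 1) → (CSpace (m + 1)) [⋀^Fin (m + 1)]→L[ℂ] ℂ :=
    fun c z => (θ c z * (s c z ^ α)⁻¹) • stdVol (m + 1)
  have hs0 : ∀ c ∈ A, ∀ z ∈ c.U \ c.pre D, s c z ≠ 0 := fun c hc z hz h =>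
    hz.2 (((hs c hc).zero_iff z hz.1).1 h)
  have hG : IsInvariantFamily A D G := by
    intro c hc d hd f hf z hz
    obtain ⟨u, ⟨-, hu⟩, hθu⟩ := htrans c hc d hd f hf
    have h1 := hθu z hz.1
    have h2 := hu z hz.1
    have hdet : (fderiv ℂ f z).det ≠ 0 := by
      intro h0
      have := LinearMap.isUnit_iff_ker_eq_bot (fderiv ℂ f z).toLinearMap
      rw [LinearMap.isUnit_iff_isUnit_det] at this
      exact (this.2 (LinearMap.ker_eq_bot.2 (hf.immersion z hz.1))).ne_zero h0
    have h3 := hs0 c hc z hz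
    rw [h2] at h3
    have hu0 : u z ≠ 0 := left_ne_zero_of_mul h3
    have hd0 : s d (f z) ≠ 0 := right_ne_zero_of_mul h3
    -- The factor `u^α` cancels against that of `(s c)^α`, and the determinant is the one produced
    -- by pulling back `stdVol`.
    have h4 : θ c z = u z ^ α * θ d (f z) * (fderiv ℂ f z).det := by
      rw [← h1, inv_mul_cancel_right₀ hdet]
    change ((θ d (f z) * (s d (f z) ^ α)⁻¹) • stdVol (m + 1)).compContinuousLinearMap _ =
      (θ c z * (s c z ^ α)⁻¹) • stdVol (m + 1)
    have h5 : ((θ d (f z) * (s d (f z) ^ α)⁻¹) • stdVol (m + 1)).compContinuousLinearMap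
        (fderiv ℂ f z) = (θ d (f z) * (s d (f z) ^ α)⁻¹) •
          (stdVol (m + 1)).compContinuousLinearMap (fderiv ℂ f z) := rfl
    rw [h5, stdVol_comp, smul_smul, h4, h2, mul_pow]
    congr 1
    field_simp
  have hθd : ∀ d ∈ A, ∀ w ∈ d.U, DifferentiableAt ℂ (θ d) w := fun d hd w hw =>
    (hθ d hd).1.differentiableAt (d.isOpen_U.mem_nhds hw)
  have hsd : ∀ d ∈ A, ∀ w ∈ d.U, DifferentiableAt ℂ (s d) w := fun d hd w hw =>
    (hs d hd).holo.differentiableAt (d.isOpen_U.mem_nhds hw)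
  let Ω : HolVolForm O D := hG.volForm hsing hAO hA
    (fun d hd w hw => ((hθd d hd w hw.1).mul (((hsd d hd w hw.1).pow α).inv
      (pow_ne_zero _ (hs0 d hd w hw)))).smul_const _)
    (fun d hd w hw => smul_ne_zero (mul_ne_zero ((hθ d hd).2 w hw.1)
      (inv_ne_zero (pow_ne_zero _ (hs0 d hd w hw)))) (stdVol_ne_zero _))
  refine ⟨Ω, fun c z hz => ?_⟩
  obtain ⟨d, hd, h, hh⟩ := O.exists_transition_to hAO hA c.2 hz.1
  obtain ⟨V, hV, hVo, hzV⟩ := eventually_nhds_iff.1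
    (hh.eventually.and (c.1.isOpen_U.eventually_mem hz.1))
  have hpre : ∀ w ∈ V, s d (h w) = 0 ↔ w ∈ c.1.pre D := fun w hw =>
    ((hs d hd).zero_iff _ (hV w hw).1.mem.self_of_nhds).trans ((hV w hw).1.mem_pre_iff (hV w hw).2)
  -- Clearing the pole with the pulled-back defining function leaves the pullback of `θ d • stdVol`,
  -- which is regular and non-zero across `D̃`.
  refine ⟨V, fun w hw => (hV w hw).2, hVo, hzV, s d ∘ h, ⟨fun w hw => ?_, hpre, fun w hw hwD => ?_⟩,
    fun w => (θ d (h w) • stdVol (m + 1)).compContinuousLinearMap (fderiv ℂ h w),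
    fun w hw => ?_, fun w hw h0 => ?_, fun w hw => ?_⟩
  · have hhw := (hV w hw).1
    exact ((hsd d hd _ hhw.mem.self_of_nhds).comp w hhw.differentiableAt).differentiableWithinAt
  · have hhw := (hV w hw).1
    have hloc := (hs d hd).isLocalDefining d.isOpen_U hhw.mem.self_of_nhds
      ((hhw.mem_pre_iff (hV w hw).2).2 hwD)
    refine (hloc.comp (T := c.1.pre D) hhw.holo hhw.inj ?_).deriv_ne
    filter_upwards [hVo.mem_nhds hw] with y hy using (hV y hy).1.mem_pre_iff (hV y hy).2
  · have hhw := (hV w hw).1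
    have h1 : DifferentiableAt ℂ (fun w => θ d (h w) • stdVol (m + 1)) w :=
      ((hθd d hd _ hhw.mem.self_of_nhds).comp w hhw.differentiableAt).smul_const _
    exact (h1.continuousAlternatingMapCompContinuousLinearMap
      (differentiableAt_fderiv_of_eventually hhw.holo)).differentiableWithinAt
  · have hhw := (hV w hw).1
    refine smul_ne_zero ((hθ d hd).2 _ hhw.mem.self_of_nhds) (stdVol_ne_zero (m + 1))
      (ContinuousAlternatingMap.ext fun v => ?_)
    choose y hy using surjective_of_injective_clm hhw.inj
    have := DFunLike.congr_fun h0 (fun i => y (v i))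
    simpa [Function.comp_def, hy] using this
  · have hhw := (hV w hw.1).1
    have hs1 : s d (h w) ≠ 0 := fun h0 => hw.2 ((hpre w hw.1).1 h0)
    have h1 : Ω.form c w = (G d (h w)).compContinuousLinearMap (fderiv ℂ h w) :=
      hG.extendForm_eq hsing hAO hA c.2 ⟨(hV w hw.1).2, hw.2⟩ hd hhw
    rw [h1]
    ext v
    change (s d (h w)) ^ α * ((θ d (h w) * (s d (h w) ^ α)⁻¹) * stdVol (m + 1) _) =
      θ d (h w) * stdVol (m + 1) _
    field_simp

end Existence

theorem corollary2p3 {X : Type u} [TopologicalSpace X] [CompactSpace X] [T2Space X] (m : ℕ)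
    (O : ComplexOrbifold X (m + 1)) (hK : O.IsKahler)
    (D : Set X) (hD : O.IsSuborbifoldCodimOne D) (hsing : O.singularSet ⊆ D)
    (α : ℕ) (hα : 2 ≤ α) (hKD : O.AnticanonicalEq D α) (hbasic : O.BasicAssumption D α) :
    (∃ Ω : HolVolForm O D, Ω.BlowsUpToOrder α) ∧
    ∀ Ω : HolVolForm O D, Ω.BlowsUpToOrder α →
      ∃ φ : NormalToCanonMap O D,
        φ.IsHolomorphic ∧ φ.IsUnbranchedCovering (α - 1) ∧ φ.IsResidueMap Ω α ∧
        ∀ ψ : NormalToCanonMap O D, ψ.IsResidueMap Ω α → ψ = φ :=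
  ⟨hKD.exists_volForm hsing, fun _ hΩ => ⟨residueMap hΩ, residueMap_isHolomorphic hΩ,
    residueMap_isUnbranchedCovering hΩ hα, residueMap_isResidueMap hΩ,
    fun _ hψ => hψ.unique hΩ hbasic (residueMap_isResidueMap hΩ)⟩⟩
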